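/- **Setting.** Let $N\ge 1$ and let $I,J,Q,P,E,R$ be $N$-tuples of positive integers. For tuples $I=(I_1,\dots,I_N)$, $J=(J_1,\dots,J_N)$ let $\mathbb H^{I\times J}$ be the set of quaternion tensors $(a_{i_1\dots i_N j_1\dots j_N})$ with $1\le i_s\le I_s$, $1\le j_s\le J_s$. The product is the Einstein product $(\mathcal A\mathcal B)_{ik}=\sum_j a_{ij}b_{jk}$ (sum over all multi-indices $j$), $\mathcal I$ is the unit tensor, $\mathcal A^*=(\overline{a_{ji}})$ is the conjugate transpose, $\mathcal A^\dagger$ is the Moore–Penrose inverse (the unique solution of $\mathcal A\mathcal X\mathcal A=\mathcal A$, $\mathcal X\mathcal A\mathcal X=\mathcal X$, $(\mathcal A\mathcal X)^*=\mathcal A\mathcal X$, $(\mathcal X\mathcal A)^*=\mathcal X\mathcal A$), and $\mathcal L_{\mathcal A}=\mathcal I-\mathcal A^\dagger\mathcal A$, $\mathcal R_{\mathcal A}=\mathcal I-\mathcal A\mathcal A^\dagger$. For $\mathcal A\in\mathbb H^{I\times J}$, $\mathcal B\in\mathbb H^{I\times K}$ the row block tensor $(\mathcal A\ \ \mathcal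 B)\in\mathbb H^{I\times(J+K)}$ has the entries of $\mathcal A$ at the column indices $l$ with $l_s\le J_s$ for all $s$, those of $\mathcal B$ (shifted by $J$) at the $l$ with $l_s>J_s$ for all $s$, and $0$ elsewhere; column blocks $\binom{\mathcal A}{\mathcal B}$ are defined in the same way. Let $\eta\in\{\mathbf i,\mathbf j,\mathbf k\}$ and $\mathcal A^{\eta^*}=-\eta\mathcal A^*\eta$; $\mathcal A$ is $\eta$-Hermitian if $\mathcal A=\mathcal A^{\eta^*}$. Let $\mathcal A_1,\mathcal C_3\in\mathbb H^{I\times J}$, $\mathcal A_2,\mathcal H_3\in\mathbb H^{I\times Q}$, $\mathcal A_3,\mathcal C_4,\mathcal H_4,\mathcal E_3\in\mathbb H^{I\times P}$, $\mathcal A_6\in\mathbb H^{I\times E}$, $\mathcal A_8\in\mathbb H^{I\times R}$ be arbitrary, and let $\mathcal E_1,\mathcal E_2,\mathcal E_9,\mathcal E_{10}\in\mathbb H^{I\times I}$ be $\eta$-Hermitian. Consider the system $$(\ast)\quad\begin{cases}\mathcal A_1\mathcal X_3\mathcal A_1^{\eta^*}=\mathcal E_1,\quad \mathcal A_2\mathcal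 Y_3\mathcal A_2^{\eta^*}=\mathcal E_2,\quad \mathcal A_3\mathcal W=\mathcal E_3,\\ \mathcal A_6\mathcal X_1+(\mathcal A_6\mathcal X_1)^{\eta^*}+\mathcal C_3\mathcal X_3\mathcal C_3^{\eta^*}+\mathcal C_4\mathcal W\mathcal C_4^{\eta^*}=\mathcal E_9,\\ \mathcal A_8\mathcal Y_1+(\mathcal A_8\mathcal Y_1)^{\eta^*}+\mathcal H_3\mathcal Y_3\mathcal H_3^{\eta^*}+\mathcal H_4\mathcal W\mathcal H_4^{\eta^*}=\mathcal E_{10}\end{cases}$$ in the unknowns $\mathcal X_1\in\mathbb H^{E\times I}$, $\mathcal Y_1\in\mathbb H^{R\times I}$ and the $\eta$-Hermitian unknowns $\mathcal X_3\in\mathbb H^{J\times J}$, $\mathcal Y_3\in\mathbb H^{Q\times Q}$, $\mathcal W\in\mathbb H^{P\times P}$; and the associated system without symmetry constraints $$(\ast\ast)\quad\begin{cases}\mathcal A_1\mathcal X_{33}\mathcal A_1^{\eta^*}=\mathcal E_1,\quad \mathcal A_2\mathcal Y_{33}\mathcal A_2^{\eta^*}=\mathcal E_2,\quad \mathcal A_3\mathcal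 W_1=\mathcal E_3,\quad \mathcal W_1\mathcal A_3^{\eta^*}=\mathcal E_3^{\eta^*},\\ \mathcal A_6\mathcal X_{11}+\mathcal X_{12}\mathcal A_6^{\eta^*}+\mathcal C_3\mathcal X_{33}\mathcal C_3^{\eta^*}+\mathcal C_4\mathcal W_1\mathcal C_4^{\eta^*}=\mathcal E_9,\\ \mathcal A_8\mathcal Y_{11}+\mathcal Y_{12}\mathcal A_8^{\eta^*}+\mathcal H_3\mathcal Y_{33}\mathcal H_3^{\eta^*}+\mathcal H_4\mathcal W_1\mathcal H_4^{\eta^*}=\mathcal E_{10}.\end{cases}$$ **Notation.** Set $$\begin{aligned} &\widehat{\mathcal A}_4=\mathcal R_{\mathcal A_6}\mathcal C_3,\ \widehat{\mathcal C}_4=\mathcal R_{\mathcal A_6}\mathcal C_4,\ \widehat{\mathcal P}=\mathcal R_{\mathcal A_6}\mathcal E_9(\mathcal R_{\mathcal A_6})^{\eta^*},\ \widehat{\mathcal A}_5=\mathcal R_{\mathcal A_8}\mathcal H_3,\ \widehat{\mathcal C}_5=\mathcal R_{\mathcal A_8}\mathcal H_4,\ \widehat{\mathcal Q}=\mathcal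 R_{\mathcal A_8}\mathcal E_{10}(\mathcal R_{\mathcal A_8})^{\eta^*},\\ &\mathcal C_6=\widehat{\mathcal C}_4\mathcal L_{\mathcal A_3},\quad \mathcal C_7=\widehat{\mathcal C}_5\mathcal L_{\mathcal A_3},\\ &\mathcal G=\widehat{\mathcal P}-\widehat{\mathcal C}_4\mathcal A_3^\dagger\mathcal E_3\widehat{\mathcal C}_4^{\eta^*}-\widehat{\mathcal C}_4\mathcal L_{\mathcal A_3}\mathcal E_3^{\eta^*}(\mathcal A_3^\dagger)^{\eta^*}\widehat{\mathcal C}_4^{\eta^*},\\ &\mathcal F=\widehat{\mathcal Q}-\widehat{\mathcal C}_5\mathcal A_3^\dagger\mathcal E_3\widehat{\mathcal C}_5^{\eta^*}-\widehat{\mathcal C}_5\mathcal L_{\mathcal A_3}\mathcal E_3^{\eta^*}(\mathcal A_3^\dagger)^{\eta^*}\widehat{\mathcal C}_5^{\eta^*},\\ &\mathcal M_1=\mathcal R_{\widehat{\mathcal A}_4}\mathcal C_6,\ \mathcal S_1=\mathcal C_6\mathcal L_{\mathcal M_1},\ \mathcal M_2=\mathcal R_{\widehat{\mathcal A}_5}\mathcal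 C_7,\ \mathcal S_2=\mathcal C_7\mathcal L_{\mathcal M_2},\\ &\mathcal A_{11}=(\mathcal L_{\mathcal M_1}\mathcal L_{\mathcal S_1}\ \ \mathcal L_{\mathcal M_2}\mathcal L_{\mathcal S_2}),\quad \mathcal B_{11}=\binom{\mathcal R_{\mathcal C_6^{\eta^*}}}{\mathcal R_{\mathcal C_7^{\eta^*}}},\\ &\mathcal E_{11}=\mathcal M_2^\dagger\mathcal F(\mathcal C_7^\dagger)^{\eta^*}+\mathcal S_2^\dagger\mathcal S_2\mathcal C_7^\dagger\mathcal F(\mathcal M_2^\dagger)^{\eta^*}-\mathcal M_1^\dagger\mathcal G(\mathcal C_6^\dagger)^{\eta^*}-\mathcal S_1^\dagger\mathcal S_1\mathcal C_6^\dagger\mathcal G(\mathcal M_1^\dagger)^{\eta^*},\\ &\mathcal A=\mathcal R_{\mathcal A_{11}}\mathcal L_{\mathcal M_1},\ \mathcal B=\mathcal R_{\mathcal M_1^{\eta^*}}\mathcal L_{\mathcal B_{11}},\ \mathcal C=\mathcal R_{\mathcal A_{11}}\mathcal L_{\mathcal M_2},\ \mathcal D=\mathcal R_{\mathcal M_2^{\eta^*}}\mathcal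 L_{\mathcal B_{11}},\ \mathcal E=\mathcal R_{\mathcal A_{11}}\mathcal E_{11}\mathcal L_{\mathcal B_{11}},\\ &\mathcal M=\mathcal R_{\mathcal A}\mathcal C,\ \mathcal N=\mathcal D\mathcal L_{\mathcal B},\ \mathcal S=\mathcal C\mathcal L_{\mathcal M},\\ &\mathcal A_{22}=(\mathcal L_{\mathcal A_1}\ \ \mathcal L_{\widehat{\mathcal A}_4}),\ \mathcal C_{22}=\widehat{\mathcal A}_4^\dagger\mathcal C_6\mathcal L_{\mathcal M_1},\ \mathcal A_{33}=\mathcal R_{\mathcal A_{22}}\mathcal C_{22},\\ &\mathcal E_{22}=\widehat{\mathcal A}_4^\dagger\mathcal G(\widehat{\mathcal A}_4^\dagger)^{\eta^*}-\mathcal A_1^\dagger\mathcal E_1(\mathcal A_1^\dagger)^{\eta^*}-\widehat{\mathcal A}_4^\dagger\mathcal S_1\mathcal C_6^\dagger\mathcal G(\mathcal M_1^\dagger)^{\eta^*}\mathcal C_6^{\eta^*}(\widehat{\mathcal A}_4^\dagger)^{\eta^*}-\widehat{\mathcal A}_4^\dagger\mathcal C_6\mathcal M_1^\dagger\mathcal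 G(\widehat{\mathcal A}_4^\dagger)^{\eta^*},\\ &\mathcal E_{33}=\mathcal R_{\mathcal A_{22}}\mathcal E_{22}(\mathcal R_{\mathcal A_{22}})^{\eta^*},\\ &\mathcal A_{44}=(\mathcal L_{\mathcal A_2}\ \ \mathcal L_{\widehat{\mathcal A}_5}),\ \mathcal C_{44}=\widehat{\mathcal A}_5^\dagger\mathcal C_7\mathcal L_{\mathcal M_2},\ \mathcal A_{55}=\mathcal R_{\mathcal A_{44}}\mathcal C_{44},\\ &\mathcal E_{44}=\widehat{\mathcal A}_5^\dagger\mathcal F(\widehat{\mathcal A}_5^\dagger)^{\eta^*}-\mathcal A_2^\dagger\mathcal E_2(\mathcal A_2^\dagger)^{\eta^*}-\widehat{\mathcal A}_5^\dagger\mathcal S_2\mathcal C_7^\dagger\mathcal F(\mathcal M_2^\dagger)^{\eta^*}\mathcal C_7^{\eta^*}(\widehat{\mathcal A}_5^\dagger)^{\eta^*}-\widehat{\mathcal A}_5^\dagger\mathcal C_7\mathcal M_2^\dagger\mathcal F(\widehat{\mathcal A}_5^\dagger)^{\eta^*},\\ &\mathcal E_{55}=\mathcal R_{\mathcal A_{44}}\mathcal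 E_{44}(\mathcal R_{\mathcal A_{44}})^{\eta^*},\\ &\mathcal A_{66}=(\mathcal L_{\mathcal A}\ \ \mathcal L_{\mathcal A_{33}}),\ \mathcal B_{66}=\binom{\mathcal R_{\mathcal B}}{\mathcal R_{\mathcal A_{33}^{\eta^*}}},\ \mathcal C_{66}=\mathcal A^\dagger\mathcal S,\ \mathcal D_{66}=\mathcal R_{\mathcal N}\mathcal D\mathcal B^\dagger,\\ &\mathcal E_{66}=\mathcal A_{33}^\dagger\mathcal E_{33}(\mathcal A_{33}^\dagger)^{\eta^*}-\mathcal A^\dagger\mathcal E\mathcal B^\dagger+\mathcal A^\dagger\mathcal S\mathcal C^\dagger\mathcal E\mathcal N^\dagger\mathcal D\mathcal B^\dagger+\mathcal A^\dagger\mathcal C\mathcal M^\dagger\mathcal E\mathcal B^\dagger,\\ &\mathcal A_{77}=\mathcal R_{\mathcal A_{66}}\mathcal C_{66},\ \mathcal B_{77}=\mathcal D_{66}\mathcal L_{\mathcal B_{66}},\ \mathcal E_{77}=\mathcal R_{\mathcal A_{66}}\mathcal E_{66}\mathcal L_{\mathcal B_{66}},\\ &\mathcal A_{88}=(\mathcal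 L_{\mathcal M}\mathcal L_{\mathcal S}\ \ \mathcal L_{\mathcal A_{55}}),\ \mathcal B_{88}=\binom{\mathcal R_{\mathcal D}}{\mathcal R_{\mathcal A_{55}^{\eta^*}}},\ \mathcal C_{88}=\mathcal L_{\mathcal M},\ \mathcal D_{88}=\mathcal R_{\mathcal N},\\ &\mathcal E_{88}=\mathcal A_{55}^\dagger\mathcal E_{55}(\mathcal A_{55}^\dagger)^{\eta^*}+\mathcal M^\dagger\mathcal E\mathcal D^\dagger+\mathcal S^\dagger\mathcal S\mathcal C^\dagger\mathcal E\mathcal N^\dagger,\\ &\mathcal A_{99}=\mathcal R_{\mathcal A_{88}}\mathcal C_{88},\ \mathcal B_{99}=\mathcal D_{88}\mathcal L_{\mathcal B_{88}},\ \mathcal E_{99}=\mathcal R_{\mathcal A_{88}}\mathcal E_{88}\mathcal L_{\mathcal B_{88}},\\ &\widetilde{\mathcal A}=(\mathcal L_{\mathcal A_{77}}\ \ -\mathcal L_{\mathcal A_{99}}),\ \widetilde{\mathcal B}=\binom{\mathcal R_{\mathcal B_{77}}}{-\mathcal R_{\mathcal B_{99}}},\ \widetilde{\mathcal E}=\mathcal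 A_{77}^\dagger\mathcal E_{77}\mathcal B_{77}^\dagger-\mathcal A_{99}^\dagger\mathcal E_{99}\mathcal B_{99}^\dagger . \end{aligned}$$ **Theorem.** (1) The system $(\ast)$ is solvable if and only if all of the following hold: $$\begin{gathered} \mathcal R_{\mathcal A_3}\mathcal E_3=0,\quad \mathcal A_3\mathcal E_3^{\eta^*}=(\mathcal A_3\mathcal E_3^{\eta^*})^{\eta^*},\quad \mathcal R_{\mathcal A_1}\mathcal E_1=0,\quad \mathcal R_{\mathcal A_2}\mathcal E_2=0,\\ \mathcal R_{\widehat{\mathcal A}_4}\mathcal G\mathcal L_{\mathcal C_6^{\eta^*}}=0,\ \mathcal R_{\mathcal C_6}\mathcal G\mathcal L_{\widehat{\mathcal A}_4^{\eta^*}}=0,\ \mathcal R_{\mathcal M_1}\mathcal R_{\widehat{\mathcal A}_4}\mathcal G=0,\ \mathcal G\mathcal L_{\widehat{\mathcal A}_4^{\eta^*}}\mathcal L_{\mathcal M_1^{\eta^*}}=0,\\ \mathcal R_{\widehat{\mathcal A}_5}\mathcal F\mathcal L_{\mathcal C_7^{\eta^*}}=0,\ \mathcal R_{\mathcal C_7}\mathcal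 F\mathcal L_{\widehat{\mathcal A}_5^{\eta^*}}=0,\ \mathcal R_{\mathcal M_2}\mathcal R_{\widehat{\mathcal A}_5}\mathcal F=0,\ \mathcal F\mathcal L_{\widehat{\mathcal A}_5^{\eta^*}}\mathcal L_{\mathcal M_2^{\eta^*}}=0,\\ \mathcal R_{\mathcal M}\mathcal R_{\mathcal A}\mathcal E=0,\ \mathcal R_{\mathcal A}\mathcal E\mathcal L_{\mathcal D}=0,\ \mathcal E\mathcal L_{\mathcal B}\mathcal L_{\mathcal N}=0,\ \mathcal R_{\mathcal C}\mathcal E\mathcal L_{\mathcal B}=0,\\ \mathcal R_{\mathcal A_{33}}\mathcal E_{33}=0,\ \mathcal E_{33}\mathcal L_{\mathcal A_{33}^{\eta^*}}=0,\ \mathcal R_{\mathcal A_{55}}\mathcal E_{55}=0,\ \mathcal E_{55}\mathcal L_{\mathcal A_{55}^{\eta^*}}=0,\\ \mathcal R_{\mathcal A_{77}}\mathcal E_{77}=0,\ \mathcal E_{77}\mathcal L_{\mathcal B_{77}}=0,\ \mathcal R_{\mathcal A_{99}}\mathcal E_{99}=0,\ \mathcal E_{99}\mathcal L_{\mathcal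 B_{99}}=0,\ \mathcal R_{\widetilde{\mathcal A}}\widetilde{\mathcal E}\mathcal L_{\widetilde{\mathcal B}}=0. \end{gathered}$$ (2) Under these conditions, $(\mathcal X_1,\mathcal Y_1,\mathcal X_3,\mathcal Y_3,\mathcal W)$ is a solution of $(\ast)$ if and only if $$(\mathcal X_1,\mathcal Y_1,\mathcal X_3,\mathcal Y_3,\mathcal W)=\tfrac12\left(\mathcal X_{11}+\mathcal X_{12}^{\eta^*},\ \mathcal Y_{11}+\mathcal Y_{12}^{\eta^*},\ \mathcal X_{33}+\mathcal X_{33}^{\eta^*},\ \mathcal Y_{33}+\mathcal Y_{33}^{\eta^*},\ \mathcal W_1+\mathcal W_1^{\eta^*}\right)$$ where, for some choice of the arbitrary tensors $\mathcal Z_i,\mathcal K_i$ $(i=1,2,3)$, $\mathcal H_{jk}$ $(j=1,\dots,4,\ k=1,2,3)$, $\widehat{\mathcal T}_{21},\mathcal T_{31},\mathcal T_{41},\widehat{\mathcal J}_{21},\mathcal J_{31},\mathcal J_{41}$ of suitable orders, $$\begin{aligned} &\mathcal X_{11}=\mathcal A_6^\dagger\grave{\mathcal E}_1-\widehat{\mathcal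 T}_{21}\mathcal A_6^{\eta^*}+\mathcal L_{\mathcal A_6}\mathcal T_{41},\quad \mathcal X_{12}=\mathcal R_{\mathcal A_6}\grave{\mathcal E}_1(\mathcal A_6^\dagger)^{\eta^*}+\mathcal A_6\widehat{\mathcal T}_{21}+\mathcal T_{31}\mathcal R_{\mathcal A_6^{\eta^*}},\\ &\mathcal Y_{11}=\mathcal A_8^\dagger\grave{\mathcal E}_2-\widehat{\mathcal J}_{21}\mathcal A_8^{\eta^*}+\mathcal L_{\mathcal A_8}\mathcal J_{41},\quad \mathcal Y_{12}=\mathcal R_{\mathcal A_8}\grave{\mathcal E}_2(\mathcal A_8^\dagger)^{\eta^*}+\mathcal A_8\widehat{\mathcal J}_{21}+\mathcal J_{31}\mathcal R_{\mathcal A_8^{\eta^*}},\\ &\mathcal X_{33}=\mathcal A_1^\dagger\mathcal E_1(\mathcal A_1^\dagger)^{\eta^*}+\mathcal L_{\mathcal A_1}\mathcal U_1+\mathcal U_2\mathcal R_{\mathcal A_1^{\eta^*}},\quad \mathcal Y_{33}=\mathcal A_2^\dagger\mathcal E_2(\mathcal A_2^\dagger)^{\eta^*}+\mathcal L_{\mathcal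 A_2}\mathcal U_3+\mathcal U_4\mathcal R_{\mathcal A_2^{\eta^*}},\\ &\mathcal W_1=\mathcal A_3^\dagger\mathcal E_3+\mathcal L_{\mathcal A_3}\mathcal E_3^{\eta^*}(\mathcal A_3^\dagger)^{\eta^*}+\mathcal L_{\mathcal A_3}\mathcal U_5\mathcal R_{\mathcal A_3^{\eta^*}},\\ &\grave{\mathcal E}_1=\mathcal E_9-\mathcal C_3\mathcal X_3\mathcal C_3^{\eta^*}-\mathcal C_4\mathcal W\mathcal C_4^{\eta^*},\quad \grave{\mathcal E}_2=\mathcal E_{10}-\mathcal H_3\mathcal Y_3\mathcal H_3^{\eta^*}-\mathcal H_4\mathcal W\mathcal H_4^{\eta^*},\\ &\mathcal U_1=(\mathcal I\ \ 0)\left(\mathcal A_{22}^\dagger(\mathcal E_{22}-\mathcal C_{22}\mathcal V_2\mathcal C_{22}^{\eta^*})-\mathcal A_{22}^\dagger\mathcal H_{12}\mathcal A_{22}^{\eta^*}+\mathcal L_{\mathcal A_{22}}\mathcal H_{11}\right),\\ &\mathcal U_2=\left(\mathcal R_{\mathcal A_{22}}(\mathcal E_{22}-\mathcal C_{22}\mathcal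 V_2\mathcal C_{22}^{\eta^*})(\mathcal A_{22}^\dagger)^{\eta^*}+\mathcal A_{22}\mathcal A_{22}^\dagger\mathcal H_{12}+\mathcal H_{13}\mathcal R_{\mathcal A_{22}^{\eta^*}}\right)\tbinom{\mathcal I}{0},\\ &\mathcal U_3=(\mathcal I\ \ 0)\left(\mathcal A_{44}^\dagger(\mathcal E_{44}-\mathcal C_{44}\mathcal T_2\mathcal C_{44}^{\eta^*})-\mathcal A_{44}^\dagger\mathcal H_{22}\mathcal A_{44}^{\eta^*}+\mathcal L_{\mathcal A_{44}}\mathcal H_{21}\right),\\ &\mathcal U_4=\left(\mathcal R_{\mathcal A_{44}}(\mathcal E_{44}-\mathcal C_{44}\mathcal T_2\mathcal C_{44}^{\eta^*})(\mathcal A_{44}^\dagger)^{\eta^*}+\mathcal A_{44}\mathcal A_{44}^\dagger\mathcal H_{22}+\mathcal H_{23}\mathcal R_{\mathcal A_{44}^{\eta^*}}\right)\tbinom{\mathcal I}{0},\\ &\mathcal U_5=\mathcal M_1^\dagger\mathcal G(\mathcal C_6^\dagger)^{\eta^*}+\mathcal S_1^\dagger\mathcal S_1\mathcal C_6^\dagger\mathcal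 G(\mathcal M_1^\dagger)^{\eta^*}+\mathcal L_{\mathcal M_1}\mathcal L_{\mathcal S_1}\mathcal V_1+\mathcal L_{\mathcal M_1}\mathcal V_2\mathcal R_{\mathcal M_1^{\eta^*}}+\mathcal V_3\mathcal R_{\mathcal C_6^{\eta^*}},\\ &\mathcal V_0=\mathcal E_{11}-\mathcal L_{\mathcal M_1}\mathcal V_2\mathcal R_{\mathcal M_1^{\eta^*}}+\mathcal L_{\mathcal M_2}\mathcal T_2\mathcal R_{\mathcal M_2^{\eta^*}},\\ &\mathcal V_1=(\mathcal I\ \ 0)\left(\mathcal A_{11}^\dagger\mathcal V_0+\mathcal Z_1\mathcal B_{11}+\mathcal L_{\mathcal A_{11}}\mathcal Z_2\right),\quad \mathcal V_3=\left(\mathcal R_{\mathcal A_{11}}\mathcal V_0\mathcal B_{11}^\dagger-\mathcal A_{11}\mathcal Z_1-\mathcal Z_3\mathcal R_{\mathcal B_{11}}\right)\tbinom{\mathcal I}{0},\\ &\mathcal V_2=\mathcal A^\dagger\mathcal E\mathcal B^\dagger-\mathcal A^\dagger\mathcal S\mathcal C^\dagger\mathcal E\mathcal N^\dagger\mathcal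 D\mathcal B^\dagger-\mathcal A^\dagger\mathcal C\mathcal M^\dagger\mathcal E\mathcal B^\dagger+\mathcal A^\dagger\mathcal S\mathcal W_4\mathcal R_{\mathcal N}\mathcal D\mathcal B^\dagger+\mathcal L_{\mathcal A}\mathcal W_5+\mathcal W_6\mathcal R_{\mathcal B},\\ &\mathcal T_2=-\mathcal M^\dagger\mathcal E\mathcal D^\dagger-\mathcal S^\dagger\mathcal S\mathcal C^\dagger\mathcal E\mathcal N^\dagger+\mathcal L_{\mathcal M}\mathcal L_{\mathcal S}\mathcal W_7+\mathcal L_{\mathcal M}\mathcal W_4\mathcal R_{\mathcal N}+\mathcal W_8\mathcal R_{\mathcal D},\\ &\mathcal W_4=\mathcal A_{77}^\dagger\mathcal E_{77}\mathcal B_{77}^\dagger-\mathcal L_{\mathcal A_{77}}\mathcal Q_1-\mathcal Q_2\mathcal R_{\mathcal B_{77}},\\ &\mathcal W_5=(\mathcal I\ \ 0)\left(\mathcal A_{66}^\dagger(\mathcal E_{66}-\mathcal C_{66}\mathcal W_4\mathcal D_{66})-\mathcal A_{66}^\dagger\mathcal H_{32}\mathcal B_{66}+\mathcal L_{\mathcal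 A_{66}}\mathcal H_{31}\right),\\ &\mathcal W_6=\left(\mathcal R_{\mathcal A_{66}}(\mathcal E_{66}-\mathcal C_{66}\mathcal W_4\mathcal D_{66})\mathcal B_{66}^\dagger+\mathcal A_{66}\mathcal A_{66}^\dagger\mathcal H_{32}+\mathcal H_{33}\mathcal R_{\mathcal B_{66}}\right)\tbinom{\mathcal I}{0},\\ &\mathcal W_7=(\mathcal I\ \ 0)\left(\mathcal A_{88}^\dagger(\mathcal E_{88}-\mathcal C_{88}\mathcal W_4\mathcal D_{88})-\mathcal A_{88}^\dagger\mathcal H_{42}\mathcal B_{88}+\mathcal L_{\mathcal A_{88}}\mathcal H_{41}\right),\\ &\mathcal W_8=\left(\mathcal R_{\mathcal A_{88}}(\mathcal E_{88}-\mathcal C_{88}\mathcal W_4\mathcal D_{88})\mathcal B_{88}^\dagger+\mathcal A_{88}\mathcal A_{88}^\dagger\mathcal H_{42}+\mathcal H_{43}\mathcal R_{\mathcal B_{88}}\right)\tbinom{\mathcal I}{0},\\ &\mathcal Q_1=(\mathcal I\ \ 0)\left(\widetilde{\mathcal A}^\dagger\widetilde{\mathcal E}-\widetilde{\mathcal A}^\dagger\mathcal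 K_2\widetilde{\mathcal B}+\mathcal L_{\widetilde{\mathcal A}}\mathcal K_1\right),\quad \mathcal Q_2=\left(\mathcal R_{\widetilde{\mathcal A}}\widetilde{\mathcal E}\widetilde{\mathcal B}^\dagger+\widetilde{\mathcal A}\widetilde{\mathcal A}^\dagger\mathcal K_2+\mathcal K_3\mathcal R_{\widetilde{\mathcal B}}\right)\tbinom{\mathcal I}{0}. \end{aligned}$$ (3) The solutions of $(\ast)$ are exactly the tuples $\tfrac12(\mathcal X_{11}+\mathcal X_{12}^{\eta^*},\mathcal Y_{11}+\mathcal Y_{12}^{\eta^*},\mathcal X_{33}+\mathcal X_{33}^{\eta^*},\mathcal Y_{33}+\mathcal Y_{33}^{\eta^*},\mathcal W_1+\mathcal W_1^{\eta^*})$ with $(\mathcal X_{11},\mathcal X_{12},\mathcal Y_{11},\mathcal Y_{12},\mathcal X_{33},\mathcal Y_{33},\mathcal W_1)$ a solution of $(\ast\ast)$. (4) Under the conditions in (1), the general solution of $(\ast\ast)$ is given by the formulas in (2) with $\grave{\mathcal E}_1=\mathcal E_9-\mathcal C_3\mathcal X_{33}\mathcal C_3^{\eta^*}-\mathcal C_4\mathcal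 W_1\mathcal C_4^{\eta^*}$ and $\grave{\mathcal E}_2=\mathcal E_{10}-\mathcal H_3\mathcal Y_{33}\mathcal H_3^{\eta^*}-\mathcal H_4\mathcal W_1\mathcal H_4^{\eta^*}$ and the same arbitrary tensors. -/

import Mathlib

open scoped Quaternion Matrix

noncomputable section

namespace EtaSylvester

/-! ### Quaternion tensors with the Einstein product -/

/-- Multi-indices `(i_1, ..., i_N)` with `i_s` in a set of `I_s` elements. -/
abbrev MIdx {N : ℕ} (I : Fin N → ℕ) : Type := (s : Fin N) → Fin (I s)

/-- Quaternion tensors in `ℍ^{I(N) × J(M)}`.  The two groups of indices are the row and the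
column index of a matrix, so that the Einstein product (summation over all the indices of
the middle group) is the product `*` of `Matrix`, the unit tensor is `1`, and the conjugate
transpose is `ᴴ`. -/
abbrev Tensor {N M : ℕ} (I : Fin N → ℕ) (J : Fin M → ℕ) : Type :=
  Matrix (MIdx I) (MIdx J) ℍ[ℝ]

/-- The matrix product is the Einstein product. -/
theorem einstein_apply {N M K : ℕ} {I : Fin N → ℕ} {J : Fin M → ℕ} {L : Fin K → ℕ}
    (A : Tensor I J) (B : Tensor J L) (i : MIdx I) (k : MIdx L) :
    (A * B) i k = ∑ j : MIdx J, A i j * B j k := Matrix.mul_apply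

/-- Row block tensor `(A B)` in `ℍ^{I × (J + K)}`: `A` sits on the column indices with
`l_s ≤ J_s` for all `s`, `B` on those with `l_s > J_s` for all `s` (counting from one),
all the other entries vanish. -/
def rowBlock {N M : ℕ} {I : Fin N → ℕ} {J K : Fin M → ℕ} (A : Tensor I J) (B : Tensor I K) :
    Tensor I (J + K) :=
  Matrix.of fun i l =>
    if h : ∀ s, (l s).val < J s then A i fun s => ⟨(l s).val, h s⟩
    else if h' : ∀ s, J s ≤ (l s).val then
      B i fun s => ⟨(l s).val - J s, Nat.sub_lt_left_of_lt_add (h' s) (l s).isLt⟩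
    else 0

/-- Column block tensor, `A` on top of `B`, in `ℍ^{(J + K) × I}`. -/
def colBlock {N M : ℕ} {I : Fin N → ℕ} {J K : Fin M → ℕ} (A : Tensor J I) (B : Tensor K I) :
    Tensor (J + K) I :=
  Matrix.of fun l i =>
    if h : ∀ s, (l s).val < J s then A (fun s => ⟨(l s).val, h s⟩) i
    else if h' : ∀ s, J s ≤ (l s).val then
      B (fun s => ⟨(l s).val - J s, Nat.sub_lt_left_of_lt_add (h' s) (l s).isLt⟩) i
    else 0

/-- The block tensor `(I 0)` in `ℍ^{J × (J + K)}`. -/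
def selRow {M : ℕ} (J K : Fin M → ℕ) : Tensor J (J + K) :=
  rowBlock (1 : Tensor J J) (0 : Tensor J K)

/-- The block tensor with `I` on top of `0` in `ℍ^{(J + K) × J}`. -/
def selCol {M : ℕ} (J K : Fin M → ℕ) : Tensor (J + K) J :=
  colBlock (1 : Tensor J J) (0 : Tensor K J)

/-! ### The Moore-Penrose inverse -/

section MoorePenrose

variable {m n : Type} [Fintype m] [Fintype n]

/-- The four Penrose equations. -/
structure IsMoorePenrose (A : Matrix m n ℍ[ℝ]) (X : Matrix n m ℍ[ℝ]) : Prop where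
  one : A * X * A = A
  two : X * A * X = X
  three : (A * X)ᴴ = A * X
  four : (X * A)ᴴ = X * A

theorem IsMoorePenrose.unique {A : Matrix m n ℍ[ℝ]} {X Y : Matrix n m ℍ[ℝ]}
    (hX : IsMoorePenrose A X) (hY : IsMoorePenrose A Y) : X = Y := by
  have h1 : A * X = A * Y := by
    calc A * X = (A * X)ᴴ := hX.three.symm
      _ = (A * Y * (A * X))ᴴ := by rw [← Matrix.mul_assoc, hY.one]
      _ = A * X * (A * Y) := by rw [Matrix.conjTranspose_mul, hX.three, hY.three]
      _ = A * Y := by rw [← Matrix.mul_assoc, hX.one]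
  have h2 : X * A = Y * A := by
    calc X * A = (X * A)ᴴ := hX.four.symm
      _ = (X * A * (Y * A))ᴴ := by rw [Matrix.mul_assoc, ← Matrix.mul_assoc A, hY.one]
      _ = Y * A * (X * A) := by rw [Matrix.conjTranspose_mul, hX.four, hY.four]
      _ = Y * A := by rw [Matrix.mul_assoc, ← Matrix.mul_assoc A, hX.one]
  rw [← hX.two, h2, Matrix.mul_assoc, h1, ← Matrix.mul_assoc, hY.two]

theorem exists_inner [DecidableEq m] [DecidableEq n] (A : Matrix m n ℍ[ℝ]) : ∃ G : Matrix n m ℍ[ℝ], A * G * A = A := by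
  let f : (m → ℍ[ℝ]) →ₗ[ℍ[ℝ]] (n → ℍ[ℝ]) := Matrix.toLinearMapRight' A
  obtain ⟨h, hh⟩ := f.rangeRestrict.exists_rightInverse_of_surjective f.range_rangeRestrict
  obtain ⟨g, hg⟩ := LinearMap.exists_extend h
  refine ⟨Matrix.toLinearMapRight'.symm g, ?_⟩
  apply Matrix.toLinearMapRight'.injective
  refine LinearMap.ext fun v => ?_
  rw [Matrix.toLinearMapRight'_mul_apply, Matrix.toLinearMapRight'_mul_apply]
  have e1 : Matrix.toLinearMapRight' (Matrix.toLinearMapRight'.symm g) = g :=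
    LinearEquiv.apply_symm_apply _ _
  have e2 : g (f v) = h (f.rangeRestrict v) := LinearMap.congr_fun hg (f.rangeRestrict v)
  have e3 : f.rangeRestrict (h (f.rangeRestrict v)) = f.rangeRestrict v :=
    LinearMap.congr_fun hh (f.rangeRestrict v)
  rw [e1]
  change f (g (f v)) = f v
  rw [e2]
  exact congrArg Subtype.val e3

theorem eq_zero_of_conjTranspose_mul_self {k : Type} [Fintype k] {A : Matrix m k ℍ[ℝ]}
    (h : Aᴴ * A = 0) : A = 0 := by
  ext1 i j
  have h1 : ∑ i, star (A i j) * A i j = 0 := by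
    have := congrFun (congrFun h j) j
    simpa [Matrix.mul_apply] using this
  have h2 : ∑ i, Quaternion.normSq (A i j) = 0 := by
    have : algebraMap ℝ ℍ[ℝ] (∑ i, Quaternion.normSq (A i j)) = 0 := by
      rw [← h1]
      rw [map_sum]
      refine Finset.sum_congr rfl fun x _ => ?_
      rw [Quaternion.star_mul_self]
      rfl
    exact (map_eq_zero _).1 this
  have h3 := (Finset.sum_eq_zero_iff_of_nonneg
    (fun i _ => Quaternion.normSq_nonneg (a := A i j))).1 h2 i (Finset.mem_univ i)
  simpa using h3

theorem exists_isMoorePenrose [DecidableEq m] [DecidableEq n] (A : Matrix m n ℍ[ℝ]) : ∃ X, IsMoorePenrose A X := by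
  have key : ∀ {p q : Type} [Fintype p] [DecidableEq p] [Fintype q] [DecidableEq q]
      (B : Matrix p q ℍ[ℝ]), ∃ U : Matrix q p ℍ[ℝ], B * U * B = B ∧ (B * U)ᴴ = B * U := by
    intro p q _ _ _ _ B
    obtain ⟨G, hG⟩ := exists_inner (Bᴴ * B)
    have h0 : B * (G * Bᴴ) * B = B := by
      rw [← sub_eq_zero]
      apply eq_zero_of_conjTranspose_mul_self
      have : Bᴴ * (B * (G * Bᴴ) * B - B) = 0 := by
        rw [Matrix.mul_sub, sub_eq_zero]
        simpa only [Matrix.mul_assoc] using hG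
      have e : B * (G * Bᴴ) * B - B = B * (G * Bᴴ * B - 1) := by
        rw [Matrix.mul_sub, Matrix.mul_one, Matrix.mul_assoc, Matrix.mul_assoc]
      rw [e] at this ⊢
      rw [Matrix.conjTranspose_mul, Matrix.mul_assoc, this, Matrix.mul_zero]
    refine ⟨G * Bᴴ, h0, ?_⟩
    have h1 : B * (G * Bᴴ) * (B * (G * Bᴴ))ᴴ = B * (G * Bᴴ) := by
      have : Bᴴ * (B * (G * Bᴴ))ᴴ = Bᴴ := by rw [← Matrix.conjTranspose_mul, h0]
      calc _ = B * G * (Bᴴ * (B * (G * Bᴴ))ᴴ) := by simp only [Matrix.mul_assoc]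
        _ = _ := by rw [this, Matrix.mul_assoc]
    calc (B * (G * Bᴴ))ᴴ = (B * (G * Bᴴ) * (B * (G * Bᴴ))ᴴ)ᴴ := by rw [h1]
      _ = B * (G * Bᴴ) * (B * (G * Bᴴ))ᴴ := by
        rw [Matrix.conjTranspose_mul, Matrix.conjTranspose_conjTranspose]
      _ = _ := h1
  obtain ⟨U, hU, hU'⟩ := key A
  obtain ⟨V, hV, hV'⟩ := key Aᴴ
  have hV1 : A * Vᴴ * A = A := by
    have := congrArg Matrix.conjTranspose hV
    simpa [Matrix.conjTranspose_mul, Matrix.mul_assoc] using this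
  have hV2 : (Vᴴ * A)ᴴ = Vᴴ * A := by
    have := congrArg Matrix.conjTranspose hV'
    simpa [Matrix.conjTranspose_mul] using this
  have e1 : A * (Vᴴ * A * U) = A * U := by
    rw [← Matrix.mul_assoc, ← Matrix.mul_assoc, hV1]
  have e2 : Vᴴ * A * U * A = Vᴴ * A := by
    rw [Matrix.mul_assoc Vᴴ, Matrix.mul_assoc Vᴴ, hU]
  refine ⟨Vᴴ * A * U, ?_, ?_, ?_, ?_⟩
  · rw [e1, hU]
  · rw [e2, ← Matrix.mul_assoc, ← Matrix.mul_assoc, Matrix.mul_assoc Vᴴ A, Matrix.mul_assoc Vᴴ, hV1]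
  · rw [e1, hU']
  · rw [e2, hV2]

/-- The Moore-Penrose inverse: the unique solution of the four Penrose equations. -/
def mpInv [DecidableEq m] [DecidableEq n] (A : Matrix m n ℍ[ℝ]) : Matrix n m ℍ[ℝ] :=
  Classical.choose (exists_isMoorePenrose A)

theorem mpInv_spec [DecidableEq m] [DecidableEq n] (A : Matrix m n ℍ[ℝ]) :
    IsMoorePenrose A (mpInv A) :=
  Classical.choose_spec (exists_isMoorePenrose A)

local postfix:max "†" => mpInv

/-- The projection `L_A = I - A† A`. -/
def projL [DecidableEq m] [DecidableEq n] (A : Matrix m n ℍ[ℝ]) : Matrix n n ℍ[ℝ] :=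
  1 - A† * A

/-- The projection `R_A = I - A A†`. -/
def projR [DecidableEq m] [DecidableEq n] (A : Matrix m n ℍ[ℝ]) : Matrix m m ℍ[ℝ] :=
  1 - A * A†

/-- `η` is one of the basis elements `i`, `j`, `k`. -/
def IsBasisUnit (η : ℍ[ℝ]) : Prop :=
  η = ⟨0, 1, 0, 0⟩ ∨ η = ⟨0, 0, 1, 0⟩ ∨ η = ⟨0, 0, 0, 1⟩

/-- The `η`-conjugate transpose `A^{η*} = -η A* η`. -/
def etaConj (η : ℍ[ℝ]) (A : Matrix m n ℍ[ℝ]) : Matrix n m ℍ[ℝ] :=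
  Matrix.of fun j i => -(η * Aᴴ j i * η)

/-- `A` is `η`-Hermitian: `A = A^{η*}`. -/
def IsEtaHermitian (η : ℍ[ℝ]) (A : Matrix m m ℍ[ℝ]) : Prop := A = etaConj η A

end MoorePenrose

local postfix:max "†" => mpInv

/-! ### The system -/

/-- The coefficients and right-hand sides of the system, with the basis element `η`. -/
structure Coeffs {N : ℕ} (dI dJ dQ dP dE dR : Fin N → ℕ) where
  η : ℍ[ℝ]
  A1 : Tensor dI dJ
  A2 : Tensor dI dQ
  A3 : Tensor dI dP
  A6 : Tensor dI dE
  A8 : Tensor dI dR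
  C3 : Tensor dI dJ
  C4 : Tensor dI dP
  H3 : Tensor dI dQ
  H4 : Tensor dI dP
  E1 : Tensor dI dI
  E2 : Tensor dI dI
  E3 : Tensor dI dP
  E9 : Tensor dI dI
  E10 : Tensor dI dI

/-- The arbitrary tensors in the general solution.  `Z1, Z2, Z3` are the arbitrary tensors
in `V1` and `V3`; the `T`s and `J`s are those in `X11, X12` and `Y11, Y12`. -/
structure Params {N : ℕ} (dI dJ dQ dP dE dR : Fin N → ℕ) where
  Z1 : Tensor (dP + dP) (dP + dP)
  Z2 : Tensor (dP + dP) dP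
  Z3 : Tensor dP (dP + dP)
  K1 : Tensor (dP + dP) dP
  K2 : Tensor dP (dP + dP)
  K3 : Tensor dP (dP + dP)
  H11 : Tensor (dJ + dJ) dJ
  H12 : Tensor dJ (dJ + dJ)
  H13 : Tensor dJ (dJ + dJ)
  H21 : Tensor (dQ + dQ) dQ
  H22 : Tensor dQ (dQ + dQ)
  H23 : Tensor dQ (dQ + dQ)
  H31 : Tensor (dP + dP) dP
  H32 : Tensor dP (dP + dP)
  H33 : Tensor dP (dP + dP)
  H41 : Tensor (dP + dP) dP
  H42 : Tensor dP (dP + dP)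
  H43 : Tensor dP (dP + dP)
  That21 : Tensor dE dE
  T31 : Tensor dI dE
  T41 : Tensor dE dI
  Jhat21 : Tensor dR dR
  J31 : Tensor dI dR
  J41 : Tensor dR dI

namespace Coeffs

variable {N : ℕ} {dI dJ dQ dP dE dR : Fin N → ℕ} (S : Coeffs dI dJ dQ dP dE dR)

/-- `A^{η*}` for the basis element `η` of the system. -/
abbrev ec {m n : Type} (A : Matrix m n ℍ[ℝ]) : Matrix n m ℍ[ℝ] := etaConj S.η A

/-- `(X1, Y1, X3, Y3, W)` solves the system, with `X3`, `Y3`, `W` `η`-Hermitian. -/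
structure IsSolution (X1 : Tensor dE dI) (Y1 : Tensor dR dI) (X3 : Tensor dJ dJ)
    (Y3 : Tensor dQ dQ) (W : Tensor dP dP) : Prop where
  eq1 : S.A1 * X3 * S.ec S.A1 = S.E1
  eq2 : S.A2 * Y3 * S.ec S.A2 = S.E2
  eq3 : S.A3 * W = S.E3
  eq9 : S.A6 * X1 + S.ec (S.A6 * X1) + S.C3 * X3 * S.ec S.C3 + S.C4 * W * S.ec S.C4 = S.E9
  eq10 : S.A8 * Y1 + S.ec (S.A8 * Y1) + S.H3 * Y3 * S.ec S.H3 + S.H4 * W * S.ec S.H4 = S.E10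
  hermX3 : IsEtaHermitian S.η X3
  hermY3 : IsEtaHermitian S.η Y3
  hermW : IsEtaHermitian S.η W

/-- The system has a solution. -/
def Solvable : Prop := ∃ X1 Y1 X3 Y3 W, S.IsSolution X1 Y1 X3 Y3 W

/-- `(X11, X12, Y11, Y12, X33, Y33, W1)` solves the associated system without symmetry
constraints on the unknowns. -/
structure IsAuxSolution (X11 : Tensor dE dI) (X12 : Tensor dI dE) (Y11 : Tensor dR dI)
    (Y12 : Tensor dI dR) (X33 : Tensor dJ dJ) (Y33 : Tensor dQ dQ) (W1 : Tensor dP dP) :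
    Prop where
  eq1 : S.A1 * X33 * S.ec S.A1 = S.E1
  eq2 : S.A2 * Y33 * S.ec S.A2 = S.E2
  eq3 : S.A3 * W1 = S.E3
  eq4 : W1 * S.ec S.A3 = S.ec S.E3
  eq9 : S.A6 * X11 + X12 * S.ec S.A6 + S.C3 * X33 * S.ec S.C3 + S.C4 * W1 * S.ec S.C4 = S.E9
  eq10 : S.A8 * Y11 + Y12 * S.ec S.A8 + S.H3 * Y33 * S.ec S.H3 + S.H4 * W1 * S.ec S.H4 = S.E10

/-! ### The tensors built from the coefficients -/

def Ahat4 : Tensor dI dJ := projR S.A6 * S.C3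
def Chat4 : Tensor dI dP := projR S.A6 * S.C4
def Phat : Tensor dI dI := projR S.A6 * S.E9 * S.ec (projR S.A6)
def Ahat5 : Tensor dI dQ := projR S.A8 * S.H3
def Chat5 : Tensor dI dP := projR S.A8 * S.H4
def Qhat : Tensor dI dI := projR S.A8 * S.E10 * S.ec (projR S.A8)

def C6 : Tensor dI dP := S.Chat4 * projL S.A3
def C7 : Tensor dI dP := S.Chat5 * projL S.A3

def G : Tensor dI dI :=
  S.Phat - S.Chat4 * S.A3† * S.E3 * S.ec S.Chat4
    - S.Chat4 * projL S.A3 * S.ec S.E3 * S.ec S.A3† * S.ec S.Chat4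

def F : Tensor dI dI :=
  S.Qhat - S.Chat5 * S.A3† * S.E3 * S.ec S.Chat5
    - S.Chat5 * projL S.A3 * S.ec S.E3 * S.ec S.A3† * S.ec S.Chat5

def M1 : Tensor dI dP := projR S.Ahat4 * S.C6
def S1 : Tensor dI dP := S.C6 * projL S.M1
def M2 : Tensor dI dP := projR S.Ahat5 * S.C7
def S2 : Tensor dI dP := S.C7 * projL S.M2

def A11 : Tensor dP (dP + dP) :=
  rowBlock (projL S.M1 * projL S.S1 : Tensor dP dP) (projL S.M2 * projL S.S2 : Tensor dP dP)

def B11 : Tensor (dP + dP) dP :=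
  colBlock (projR (S.ec S.C6) : Tensor dP dP) (projR (S.ec S.C7) : Tensor dP dP)

def E11 : Tensor dP dP :=
  S.M2† * S.F * S.ec S.C7† + S.S2† * S.S2 * S.C7† * S.F * S.ec S.M2†
    - S.M1† * S.G * S.ec S.C6† - S.S1† * S.S1 * S.C6† * S.G * S.ec S.M1†

def A : Tensor dP dP := projR S.A11 * projL S.M1
def B : Tensor dP dP := projR (S.ec S.M1) * projL S.B11
def C : Tensor dP dP := projR S.A11 * projL S.M2
def D : Tensor dP dP := projR (S.ec S.M2) * projL S.B11
def E : Tensor dP dP := projR S.A11 * S.E11 * projL S.B11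
def M : Tensor dP dP := projR S.A * S.C
def N' : Tensor dP dP := S.D * projL S.B
def S' : Tensor dP dP := S.C * projL S.M

def A22 : Tensor dJ (dJ + dJ) :=
  rowBlock (projL S.A1 : Tensor dJ dJ) (projL S.Ahat4 : Tensor dJ dJ)
def C22 : Tensor dJ dP := S.Ahat4† * S.C6 * projL S.M1
def A33 : Tensor dJ dP := projR S.A22 * S.C22

def E22 : Tensor dJ dJ :=
  S.Ahat4† * S.G * S.ec S.Ahat4† - S.A1† * S.E1 * S.ec S.A1†
    - S.Ahat4† * S.S1 * S.C6† * S.G * S.ec S.M1† * S.ec S.C6 * S.ec S.Ahat4†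
    - S.Ahat4† * S.C6 * S.M1† * S.G * S.ec S.Ahat4†

def E33 : Tensor dJ dJ := projR S.A22 * S.E22 * S.ec (projR S.A22)

def A44 : Tensor dQ (dQ + dQ) :=
  rowBlock (projL S.A2 : Tensor dQ dQ) (projL S.Ahat5 : Tensor dQ dQ)
def C44 : Tensor dQ dP := S.Ahat5† * S.C7 * projL S.M2

def E44 : Tensor dQ dQ :=
  S.Ahat5† * S.F * S.ec S.Ahat5† - S.A2† * S.E2 * S.ec S.A2†
    - S.Ahat5† * S.S2 * S.C7† * S.F * S.ec S.M2† * S.ec S.C7 * S.ec S.Ahat5†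
    - S.Ahat5† * S.C7 * S.M2† * S.F * S.ec S.Ahat5†

def A55 : Tensor dQ dP := projR S.A44 * S.C44
def E55 : Tensor dQ dQ := projR S.A44 * S.E44 * S.ec (projR S.A44)

def A66 : Tensor dP (dP + dP) :=
  rowBlock (projL S.A : Tensor dP dP) (projL S.A33 : Tensor dP dP)
def B66 : Tensor (dP + dP) dP :=
  colBlock (projR S.B : Tensor dP dP) (projR (S.ec S.A33) : Tensor dP dP)
def C66 : Tensor dP dP := S.A† * S.S'
def D66 : Tensor dP dP := projR S.N' * S.D * S.B†

def E66 : Tensor dP dP :=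
  S.A33† * S.E33 * S.ec S.A33† - S.A† * S.E * S.B†
    + S.A† * S.S' * S.C† * S.E * S.N'† * S.D * S.B†
    + S.A† * S.C * S.M† * S.E * S.B†

def A77 : Tensor dP dP := projR S.A66 * S.C66
def B77 : Tensor dP dP := S.D66 * projL S.B66
def E77 : Tensor dP dP := projR S.A66 * S.E66 * projL S.B66

def A88 : Tensor dP (dP + dP) :=
  rowBlock (projL S.M * projL S.S' : Tensor dP dP) (projL S.A55 : Tensor dP dP)
def B88 : Tensor (dP + dP) dP :=
  colBlock (projR S.D : Tensor dP dP) (projR (S.ec S.A55) : Tensor dP dP)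
def C88 : Tensor dP dP := projL S.M
def D88 : Tensor dP dP := projR S.N'

def E88 : Tensor dP dP :=
  S.A55† * S.E55 * S.ec S.A55† + S.M† * S.E * S.D† + S.S'† * S.S' * S.C† * S.E * S.N'†

def A99 : Tensor dP dP := projR S.A88 * S.C88
def B99 : Tensor dP dP := S.D88 * projL S.B88
def E99 : Tensor dP dP := projR S.A88 * S.E88 * projL S.B88

def Atilde : Tensor dP (dP + dP) :=
  rowBlock (projL S.A77 : Tensor dP dP) (-projL S.A99 : Tensor dP dP)
def Btilde : Tensor (dP + dP) dP :=
  colBlock (projR S.B77 : Tensor dP dP) (-projR S.B99 : Tensor dP dP)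
def Etilde : Tensor dP dP := S.A77† * S.E77 * S.B77† - S.A99† * S.E99 * S.B99†

/-- The solvability conditions. -/
structure Conditions : Prop where
  c1 : projR S.A3 * S.E3 = 0
  c2 : S.A3 * S.ec S.E3 = S.ec (S.A3 * S.ec S.E3)
  c3 : projR S.A1 * S.E1 = 0
  c4 : projR S.A2 * S.E2 = 0
  c5 : projR S.Ahat4 * S.G * projL (S.ec S.C6) = 0
  c6 : projR S.C6 * S.G * projL (S.ec S.Ahat4) = 0
  c7 : projR S.M1 * projR S.Ahat4 * S.G = 0
  c8 : S.G * projL (S.ec S.Ahat4) * projL (S.ec S.M1) = 0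
  c9 : projR S.Ahat5 * S.F * projL (S.ec S.C7) = 0
  c10 : projR S.C7 * S.F * projL (S.ec S.Ahat5) = 0
  c11 : projR S.M2 * projR S.Ahat5 * S.F = 0
  c12 : S.F * projL (S.ec S.Ahat5) * projL (S.ec S.M2) = 0
  c13 : projR S.M * projR S.A * S.E = 0
  c14 : projR S.A * S.E * projL S.D = 0
  c15 : S.E * projL S.B * projL S.N' = 0
  c16 : projR S.C * S.E * projL S.B = 0
  c17 : projR S.A33 * S.E33 = 0
  c18 : S.E33 * projL (S.ec S.A33) = 0
  c19 : projR S.A55 * S.E55 = 0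
  c20 : S.E55 * projL (S.ec S.A55) = 0
  c21 : projR S.A77 * S.E77 = 0
  c22 : S.E77 * projL S.B77 = 0
  c23 : projR S.A99 * S.E99 = 0
  c24 : S.E99 * projL S.B99 = 0
  c25 : projR S.Atilde * S.Etilde * projL S.Btilde = 0

/-! ### The tensors in the general solution -/

variable (p : Params dI dJ dQ dP dE dR)

def Q1 : Tensor dP dP :=
  selRow dP dP * (S.Atilde† * S.Etilde - S.Atilde† * p.K2 * S.Btilde + projL S.Atilde * p.K1)

def Q2 : Tensor dP dP :=
  (projR S.Atilde * S.Etilde * S.Btilde† + S.Atilde * S.Atilde† * p.K2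
    + p.K3 * projR S.Btilde) * selCol dP dP

def W4 : Tensor dP dP :=
  S.A77† * S.E77 * S.B77† - projL S.A77 * S.Q1 p - S.Q2 p * projR S.B77

def W5 : Tensor dP dP :=
  selRow dP dP * (S.A66† * (S.E66 - S.C66 * S.W4 p * S.D66) - S.A66† * p.H32 * S.B66
    + projL S.A66 * p.H31)

def W6 : Tensor dP dP :=
  (projR S.A66 * (S.E66 - S.C66 * S.W4 p * S.D66) * S.B66† + S.A66 * S.A66† * p.H32
    + p.H33 * projR S.B66) * selCol dP dP

def W7 : Tensor dP dP :=
  selRow dP dP * (S.A88† * (S.E88 - S.C88 * S.W4 p * S.D88) - S.A88† * p.H42 * S.B88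
    + projL S.A88 * p.H41)

def W8 : Tensor dP dP :=
  (projR S.A88 * (S.E88 - S.C88 * S.W4 p * S.D88) * S.B88† + S.A88 * S.A88† * p.H42
    + p.H43 * projR S.B88) * selCol dP dP

def V2 : Tensor dP dP :=
  S.A† * S.E * S.B† - S.A† * S.S' * S.C† * S.E * S.N'† * S.D * S.B†
    - S.A† * S.C * S.M† * S.E * S.B† + S.A† * S.S' * S.W4 p * projR S.N' * S.D * S.B†
    + projL S.A * S.W5 p + S.W6 p * projR S.B

def T2 : Tensor dP dP :=
  -(S.M† * S.E * S.D†) - S.S'† * S.S' * S.C† * S.E * S.N'†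
    + projL S.M * projL S.S' * S.W7 p + projL S.M * S.W4 p * projR S.N' + S.W8 p * projR S.D

/-- The right-hand side common to `V1` and `V3`. -/
def V0 : Tensor dP dP :=
  S.E11 - projL S.M1 * S.V2 p * projR (S.ec S.M1) + projL S.M2 * S.T2 p * projR (S.ec S.M2)

def V1 : Tensor dP dP :=
  selRow dP dP * (S.A11† * S.V0 p + p.Z1 * S.B11 + projL S.A11 * p.Z2)

def V3 : Tensor dP dP :=
  (projR S.A11 * S.V0 p * S.B11† - S.A11 * p.Z1 - p.Z3 * projR S.B11) * selCol dP dP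

def U1 : Tensor dJ dJ :=
  selRow dJ dJ * (S.A22† * (S.E22 - S.C22 * S.V2 p * S.ec S.C22)
    - S.A22† * p.H12 * S.ec S.A22 + projL S.A22 * p.H11)

def U2 : Tensor dJ dJ :=
  (projR S.A22 * (S.E22 - S.C22 * S.V2 p * S.ec S.C22) * S.ec S.A22†
    + S.A22 * S.A22† * p.H12 + p.H13 * projR (S.ec S.A22)) * selCol dJ dJ

def U3 : Tensor dQ dQ :=
  selRow dQ dQ * (S.A44† * (S.E44 - S.C44 * S.T2 p * S.ec S.C44)
    - S.A44† * p.H22 * S.ec S.A44 + projL S.A44 * p.H21)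

def U4 : Tensor dQ dQ :=
  (projR S.A44 * (S.E44 - S.C44 * S.T2 p * S.ec S.C44) * S.ec S.A44†
    + S.A44 * S.A44† * p.H22 + p.H23 * projR (S.ec S.A44)) * selCol dQ dQ

def U5 : Tensor dP dP :=
  S.M1† * S.G * S.ec S.C6† + S.S1† * S.S1 * S.C6† * S.G * S.ec S.M1†
    + projL S.M1 * projL S.S1 * S.V1 p + projL S.M1 * S.V2 p * projR (S.ec S.M1)
    + S.V3 p * projR (S.ec S.C6)

def X33 : Tensor dJ dJ :=
  S.A1† * S.E1 * S.ec S.A1† + projL S.A1 * S.U1 p + S.U2 p * projR (S.ec S.A1)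

def Y33 : Tensor dQ dQ :=
  S.A2† * S.E2 * S.ec S.A2† + projL S.A2 * S.U3 p + S.U4 p * projR (S.ec S.A2)

def W1 : Tensor dP dP :=
  S.A3† * S.E3 + projL S.A3 * S.ec S.E3 * S.ec S.A3†
    + projL S.A3 * S.U5 p * projR (S.ec S.A3)

/-- `E9 - C3 X C3^{η*} - C4 Z C4^{η*}`. -/
def Egrave1 (X : Tensor dJ dJ) (Z : Tensor dP dP) : Tensor dI dI :=
  S.E9 - S.C3 * X * S.ec S.C3 - S.C4 * Z * S.ec S.C4

/-- `E10 - H3 Y H3^{η*} - H4 Z H4^{η*}`. -/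
def Egrave2 (Y : Tensor dQ dQ) (Z : Tensor dP dP) : Tensor dI dI :=
  S.E10 - S.H3 * Y * S.ec S.H3 - S.H4 * Z * S.ec S.H4

/-- `X11` as a function of the tensor `Egrave1`; similarly below. -/
def X11 (Eg : Tensor dI dI) : Tensor dE dI :=
  S.A6† * Eg - p.That21 * S.ec S.A6 + projL S.A6 * p.T41

def X12 (Eg : Tensor dI dI) : Tensor dI dE :=
  projR S.A6 * Eg * S.ec S.A6† + S.A6 * p.That21 + p.T31 * projR (S.ec S.A6)

def Y11 (Eg : Tensor dI dI) : Tensor dR dI :=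
  S.A8† * Eg - p.Jhat21 * S.ec S.A8 + projL S.A8 * p.J41

def Y12 (Eg : Tensor dI dI) : Tensor dI dR :=
  projR S.A8 * Eg * S.ec S.A8† + S.A8 * p.Jhat21 + p.J31 * projR (S.ec S.A8)

/-- `(X + X^{η*}) / 2`, or more generally `(X + Y^{η*}) / 2`. -/
def symm {m n : Type} (X : Matrix m n ℍ[ℝ]) (Y : Matrix n m ℍ[ℝ]) : Matrix m n ℍ[ℝ] :=
  (2⁻¹ : ℝ) • (X + S.ec Y)

end Coeffs

end EtaSylvester

end

/-! The `η`-conjugation is a real-linear involution that reverses products. It maps the associated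
system to itself once `X11`, `X12` and `Y11`, `Y12` are exchanged, so averaging a solution with its
conjugate solves the symmetric system. Conversely, a symmetric solution becomes an associated one by
taking `X12` and `Y12` to be the conjugates of `X1` and `Y1`. Hence everything reduces to solving
the associated system (`isAuxSolution_iff`).

That system is solved by elimination with three linear equations whose solvability conditions and
general solutions are explicit: `A X B = C` (`mul_mul_eq_iff`), `A X + Y B = C` (`sylvester_iff`)
and `A X B + C Y D = E` (`two_term_iff`). The equations with right-hand sides `E1`, `E2`, `E3`
parametrize `X33`, `Y33`, `W1` by `U1`, ..., `U5`. The equation for `E9` is a Sylvester equation in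
`X11`, `X12`; its solvability condition is a two-term equation in `X33` and `U5`, with right-hand
side `G`. The equation for `E10` likewise gives one in `Y33` and `U5`, with right-hand side `F`.

The two-term equations yield second parametrizations of `X33` and `Y33` and two parametrizations of
`U5`. Equating two parametrizations of one unknown is a Sylvester equation with block coefficients.
Its solutions give the outer parameters, and its solvability condition is a smaller equation for the
inner ones: `X33` gives `A33 V2 A33^{η*} = E33`, `Y33` gives `A55 T2 A55^{η*} = E55`, and `U5` gives
`A V2 B - C T2 D = E`. The last equation parametrizes `V2` and `T2` again, now with a shared inner
parameter `W4`. Matching `V2` and `T2` gives `A77 W4 B77 = E77` and `A99 W4 B99 = E99`; matching the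
two resulting forms of `W4` leaves a condition without unknowns. Every step is an equivalence, so
the conditions met on the way are necessary and sufficient, and the parameters left over are the
arbitrary tensors. -/

namespace EtaSylvester

local postfix:max "†" => mpInv

/-! ### Moore-Penrose inverses and their projections -/

section Projections

variable {m n : Type} [Fintype m] [Fintype n] [DecidableEq m] [DecidableEq n]

theorem mul_mpInv_mul (A : Matrix m n ℍ[ℝ]) : A * A† * A = A := (mpInv_spec A).one

theorem mpInv_mul_mpInv (A : Matrix m n ℍ[ℝ]) : A† * A * A† = A† := (mpInv_spec A).two

theorem mul_projL_self (A : Matrix m n ℍ[ℝ]) : A * projL A = 0 := by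
  rw [projL, Matrix.mul_sub, Matrix.mul_one, ← Matrix.mul_assoc, mul_mpInv_mul, sub_self]

theorem projR_mul_self (A : Matrix m n ℍ[ℝ]) : projR A * A = 0 := by
  rw [projR, Matrix.sub_mul, Matrix.one_mul, mul_mpInv_mul, sub_self]

theorem projL_conjTranspose (A : Matrix m n ℍ[ℝ]) : (projL A)ᴴ = projL A := by
  rw [projL, Matrix.conjTranspose_sub, Matrix.conjTranspose_one, (mpInv_spec A).four]

theorem projR_conjTranspose (A : Matrix m n ℍ[ℝ]) : (projR A)ᴴ = projR A := by
  rw [projR, Matrix.conjTranspose_sub, Matrix.conjTranspose_one, (mpInv_spec A).three]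

theorem projL_mul_projL (A : Matrix m n ℍ[ℝ]) : projL A * projL A = projL A := by
  conv_lhs => rw [projL, Matrix.sub_mul, Matrix.one_mul, Matrix.mul_assoc, ← projL,
    mul_projL_self, Matrix.mul_zero, sub_zero]

theorem projR_mul_projR (A : Matrix m n ℍ[ℝ]) : projR A * projR A = projR A := by
  conv_lhs => rw [projR, Matrix.mul_sub, Matrix.mul_one, ← Matrix.mul_assoc, ← projR,
    projR_mul_self, Matrix.zero_mul, sub_zero]

/-- `A A†` is Hermitian and `P` fixes it from the left, hence also from the right by taking
adjoints. Such identities let `M†` absorb `projR A` when `M = projR A * C`. -/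
theorem mpInv_mul_of_mul_eq {A : Matrix m n ℍ[ℝ]} {P : Matrix m m ℍ[ℝ]} (hP : Pᴴ = P)
    (h : P * A = A) : A† * P = A† := by
  have h1 : A * A† * P = A * A† := by
    calc A * A† * P = (P * A * A†)ᴴ := by
          rw [Matrix.mul_assoc P, Matrix.conjTranspose_mul, hP, (mpInv_spec A).three]
      _ = A * A† := by rw [h, (mpInv_spec A).three]
  calc A† * P = A† * (A * A† * P) := by
        rw [← Matrix.mul_assoc, ← Matrix.mul_assoc, mpInv_mul_mpInv]
    _ = A† := by rw [h1, ← Matrix.mul_assoc, mpInv_mul_mpInv]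

theorem mul_mpInv_of_mul_eq {A : Matrix m n ℍ[ℝ]} {P : Matrix n n ℍ[ℝ]} (hP : Pᴴ = P)
    (h : A * P = A) : P * A† = A† := by
  have h1 : P * (A† * A) = A† * A := by
    calc P * (A† * A) = (A† * (A * P))ᴴ := by
          rw [← Matrix.mul_assoc A†, Matrix.conjTranspose_mul, hP, (mpInv_spec A).four]
      _ = A† * A := by rw [h, (mpInv_spec A).four]
  calc P * A† = P * (A† * A) * A† := by
        rw [Matrix.mul_assoc, mpInv_mul_mpInv]
    _ = A† := by rw [h1, mpInv_mul_mpInv]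

theorem mul_mpInv_mul_of_projR {k : Type} {A : Matrix m n ℍ[ℝ]} {C : Matrix m k ℍ[ℝ]}
    (h : projR A * C = 0) : A * A† * C = C := by
  rw [projR, Matrix.sub_mul, Matrix.one_mul, sub_eq_zero] at h
  exact h.symm

theorem mul_mpInv_mul_of_projL {k : Type} {B : Matrix m n ℍ[ℝ]} {C : Matrix k n ℍ[ℝ]}
    (h : C * projL B = 0) : C * (B† * B) = C := by
  rw [projL, Matrix.mul_sub, Matrix.mul_one, sub_eq_zero] at h
  exact h.symm

end Projections

/-! ### General solutions of linear matrix equations -/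

section Equations

variable {m n k l p q : Type} [Fintype m] [Fintype n] [Fintype k] [Fintype l] [Fintype p]
  [Fintype q] [DecidableEq m] [DecidableEq n] [DecidableEq k] [DecidableEq l] [DecidableEq p]
  [DecidableEq q]

/-- Split `X = projL A * X + A†A X`. The hypothesis gives `A†A X B B† = 0`, so the second summand is
unchanged by `projR B` on the right. -/
theorem exists_of_mul_mul_eq_zero {A : Matrix m n ℍ[ℝ]} {B : Matrix k l ℍ[ℝ]}
    {X : Matrix n k ℍ[ℝ]} (h : A * X * B = 0) :
    ∃ U V : Matrix n k ℍ[ℝ], X = projL A * U + V * projR B := by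
  refine ⟨X, A† * A * X, ?_⟩
  have h' : A† * A * X * (B * B†) = 0 := by
    calc _ = A† * (A * X * B) * B† := by simp only [Matrix.mul_assoc]
      _ = 0 := by rw [h, Matrix.mul_zero, Matrix.zero_mul]
  rw [projL, projR, Matrix.sub_mul, Matrix.mul_sub, h', Matrix.one_mul, Matrix.mul_one]
  abel

/-- The general solution of `A X B = C`. -/
theorem mul_mul_eq_iff {A : Matrix m n ℍ[ℝ]} {B : Matrix k l ℍ[ℝ]} {C : Matrix m l ℍ[ℝ]}
    {X : Matrix n k ℍ[ℝ]} :
    A * X * B = C ↔ projR A * C = 0 ∧ C * projL B = 0 ∧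
      ∃ U V : Matrix n k ℍ[ℝ], X = A† * C * B† + projL A * U + V * projR B := by
  have key : projR A * C = 0 → C * projL B = 0 → A * (A† * C * B†) * B = C := by
    intro h1 h2
    calc A * (A† * C * B†) * B = A * A† * C * (B† * B) := by simp only [Matrix.mul_assoc]
      _ = C := by rw [mul_mpInv_mul_of_projR h1, mul_mpInv_mul_of_projL h2]
  constructor
  · intro h
    have h1 : projR A * C = 0 := by
      rw [← h, ← Matrix.mul_assoc, ← Matrix.mul_assoc, projR_mul_self, Matrix.zero_mul,
        Matrix.zero_mul]
    have h2 : C * projL B = 0 := by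
      rw [← h, Matrix.mul_assoc, mul_projL_self, Matrix.mul_zero]
    refine ⟨h1, h2, ?_⟩
    have h3 : A * (X - A† * C * B†) * B = 0 := by
      rw [Matrix.mul_sub, Matrix.sub_mul, key h1 h2, h, sub_self]
    obtain ⟨U, V, hUV⟩ := exists_of_mul_mul_eq_zero h3
    exact ⟨U, V, by rw [add_assoc, ← hUV, add_sub_cancel]⟩
  · rintro ⟨h1, h2, U, V, rfl⟩
    have h3 : A * (projL A * U) * B = 0 := by
      rw [← Matrix.mul_assoc, mul_projL_self, Matrix.zero_mul, Matrix.zero_mul]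
    have h4 : A * (V * projR B) * B = 0 := by
      rw [Matrix.mul_assoc, Matrix.mul_assoc, projR_mul_self, Matrix.mul_zero, Matrix.mul_zero]
    rw [Matrix.mul_add, Matrix.mul_add, Matrix.add_mul, Matrix.add_mul, key h1 h2, h3, h4,
      add_zero, add_zero]

/-- The sign convention of the formula for `W4`. -/
theorem mul_mul_eq_iff' {A : Matrix m n ℍ[ℝ]} {B : Matrix k l ℍ[ℝ]} {C : Matrix m l ℍ[ℝ]}
    {X : Matrix n k ℍ[ℝ]} :
    A * X * B = C ↔ projR A * C = 0 ∧ C * projL B = 0 ∧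
      ∃ U V : Matrix n k ℍ[ℝ], X = A† * C * B† - projL A * U - V * projR B := by
  rw [mul_mul_eq_iff]
  refine and_congr_right fun _ => and_congr_right fun _ => ⟨?_, ?_⟩
  · rintro ⟨U, V, rfl⟩
    exact ⟨-U, -V, by rw [Matrix.mul_neg, Matrix.neg_mul, sub_neg_eq_add, sub_neg_eq_add]⟩
  · rintro ⟨U, V, rfl⟩
    exact ⟨-U, -V, by
      rw [Matrix.mul_neg, Matrix.neg_mul, ← sub_eq_add_neg, ← sub_eq_add_neg]⟩

theorem sylvester_projection {A : Matrix m n ℍ[ℝ]} {B : Matrix k l ℍ[ℝ]}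
    {C : Matrix m l ℍ[ℝ]} {X : Matrix n l ℍ[ℝ]} {Y : Matrix m k ℍ[ℝ]} (h : A * X + Y * B = C) :
    projR A * C * projL B = 0 := by
  rw [← h, Matrix.mul_add, Matrix.add_mul, ← Matrix.mul_assoc, projR_mul_self,
    Matrix.zero_mul, Matrix.zero_mul, Matrix.mul_assoc, Matrix.mul_assoc, mul_projL_self,
    Matrix.mul_zero, Matrix.mul_zero, add_zero]

/-- The general solution of `A X + Y B = C`. -/
theorem sylvester_iff {A : Matrix m n ℍ[ℝ]} {B : Matrix k l ℍ[ℝ]} {C : Matrix m l ℍ[ℝ]}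
    {X : Matrix n l ℍ[ℝ]} {Y : Matrix m k ℍ[ℝ]} :
    A * X + Y * B = C ↔ projR A * C * projL B = 0 ∧
      ∃ (T : Matrix n k ℍ[ℝ]) (U : Matrix n l ℍ[ℝ]) (V : Matrix m k ℍ[ℝ]),
      X = A† * C - T * B + projL A * U ∧ Y = projR A * C * B† + A * T + V * projR B := by
  constructor
  · intro h
    -- A given solution is its own source of parameters: `T = A†Y`, `U = X`, `V = projR A * Y`.
    refine ⟨sylvester_projection h, A† * Y, X, projR A * Y, ?_, ?_⟩
    · rw [← h, projL, Matrix.mul_add, Matrix.sub_mul, Matrix.one_mul]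
      simp only [Matrix.mul_assoc]
      abel
    · rw [← h, Matrix.mul_add, ← Matrix.mul_assoc (projR A), projR_mul_self, Matrix.zero_mul,
        zero_add]
      have h1 : projR A * (Y * B) * B† + projR A * Y * projR B = projR A * Y := by
        rw [projR, projR, Matrix.mul_sub _ 1, Matrix.mul_one]
        simp only [Matrix.mul_assoc]
        abel
      have h2 : projR A * Y + A * (A† * Y) = Y := by
        rw [projR, Matrix.sub_mul, Matrix.one_mul, Matrix.mul_assoc, sub_add_cancel]
      rw [add_right_comm, h1, h2]
  · rintro ⟨h, T, U, V, rfl, rfl⟩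
    have h1 : projR A * C * B† * B = projR A * C := by
      rw [Matrix.mul_assoc, mul_mpInv_mul_of_projL h]
    have h2 : V * projR B * B = 0 := by
      rw [Matrix.mul_assoc, projR_mul_self, Matrix.mul_zero]
    have h3 : A * (projL A * U) = 0 := by
      rw [← Matrix.mul_assoc, mul_projL_self, Matrix.zero_mul]
    rw [Matrix.mul_add, Matrix.mul_sub, Matrix.add_mul, Matrix.add_mul, h1, h2, h3, projR,
      Matrix.sub_mul, Matrix.one_mul]
    simp only [Matrix.mul_assoc]
    abel

/-- A second form of the general solution of `A X + Y B = C`. -/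
theorem sylvester_iff' {A : Matrix m n ℍ[ℝ]} {B : Matrix k l ℍ[ℝ]} {C : Matrix m l ℍ[ℝ]}
    {X : Matrix n l ℍ[ℝ]} {Y : Matrix m k ℍ[ℝ]} :
    A * X + Y * B = C ↔ projR A * C * projL B = 0 ∧
      ∃ (T : Matrix m k ℍ[ℝ]) (U : Matrix n l ℍ[ℝ]) (V : Matrix m k ℍ[ℝ]),
      X = A† * C - A† * T * B + projL A * U ∧
      Y = projR A * C * B† + A * A† * T + V * projR B := by
  constructor
  · intro h
    obtain ⟨hC, T, U, V, hX, hY⟩ := sylvester_iff.1 h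
    have hT : A * T = A * A† * (A * T) := by rw [← Matrix.mul_assoc, mul_mpInv_mul]
    have hT' : T * B = A† * (A * T) * B + projL A * (T * B) := by
      rw [projL, Matrix.sub_mul, Matrix.one_mul]
      simp only [Matrix.mul_assoc]
      abel
    -- With `A T` as the new parameter, `T B` is replaced by `A†A T B`; the difference `projL A * (T
    -- B)` is absorbed into `U`.
    refine ⟨hC, A * T, U - T * B, V, ?_, ?_⟩
    · rw [hX, Matrix.mul_sub]
      conv_lhs => rw [hT']
      abel
    · rw [hY, ← hT]
  · rintro ⟨hC, T, U, V, hX, hY⟩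
    refine sylvester_iff.2 ⟨hC, A† * T, U, V, hX, ?_⟩
    rw [hY, Matrix.mul_assoc A]

/-- The general solution of `A X B + C Y D = E`. -/
theorem two_term_iff {A : Matrix m n ℍ[ℝ]} {B : Matrix k l ℍ[ℝ]} {C : Matrix m p ℍ[ℝ]}
    {D : Matrix q l ℍ[ℝ]} {E : Matrix m l ℍ[ℝ]} {M S : Matrix m p ℍ[ℝ]} {N : Matrix q l ℍ[ℝ]}
    (hM : M = projR A * C) (hN : N = D * projL B) (hS : S = C * projL M)
    {X : Matrix n k ℍ[ℝ]} {Y : Matrix p q ℍ[ℝ]} :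
    A * X * B + C * Y * D = E ↔
      (projR M * projR A * E = 0 ∧ projR A * E * projL D = 0 ∧ E * projL B * projL N = 0 ∧
        projR C * E * projL B = 0) ∧
      ∃ (V : Matrix p q ℍ[ℝ]) (U Z : Matrix n k ℍ[ℝ]) (W T : Matrix p q ℍ[ℝ]),
        X = A† * E * B† - A† * S * C† * E * N† * D * B† - A† * C * M† * E * B†
          - A† * S * V * projR N * D * B† + projL A * U + Z * projR B ∧
        Y = M† * E * D† + S† * S * C† * E * N† + projL M * projL S * W
          + projL M * V * projR N + T * projR D := by
  have hRM : projR A * M = M := by rw [hM, ← Matrix.mul_assoc, projR_mul_projR]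
  have hMR : M† * projR A = M† := mpInv_mul_of_mul_eq (projR_conjTranspose A) hRM
  have hNL : projL B * N† = N† := mul_mpInv_of_mul_eq (projL_conjTranspose B)
    (by rw [hN, Matrix.mul_assoc, projL_mul_projL])
  have hSL : projL M * S† = S† := mul_mpInv_of_mul_eq (projL_conjTranspose M)
    (by rw [hS, Matrix.mul_assoc, projL_mul_projL])
  have hAC : A * (A† * C) = C - M := by
    rw [hM, projR, Matrix.sub_mul, Matrix.one_mul, Matrix.mul_assoc, sub_sub_cancel]
  -- `S = C L_M` lies in the range of `A`, because `R_A S = M L_M = 0`.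
  have hAS : A * (A† * S) = S := by
    rw [hS, ← Matrix.mul_assoc A†, ← Matrix.mul_assoc A, hAC, Matrix.sub_mul, mul_projL_self,
      sub_zero]
  have hDB : D * (B† * B) = D - N := by
    rw [hN, projL, Matrix.mul_sub, Matrix.mul_one, sub_sub_cancel]
  have hCS : C * (S† * S) = S := by
    calc C * (S† * S) = C * (projL M * S† * S) := by rw [hSL]
      _ = C * projL M * S† * S := by simp only [Matrix.mul_assoc]
      _ = S := by rw [← hS, mul_mpInv_mul]
  -- Sufficiency is isolated because the necessity argument applies it to one explicit choice of
  -- parameters.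
  have sound : ∀ (V : Matrix p q ℍ[ℝ]) (U Z : Matrix n k ℍ[ℝ]) (W T : Matrix p q ℍ[ℝ]), projR M * projR A * E = 0 → projR A * E * projL D = 0 →
      E * projL B * projL N = 0 → projR C * E * projL B = 0 →
      A * (A† * E * B† - A† * S * C† * E * N† * D * B† - A† * C * M† * E * B†
          - A† * S * V * projR N * D * B† + projL A * U + Z * projR B) * B
        + C * (M† * E * D† + S† * S * C† * E * N† + projL M * projL S * W
          + projL M * V * projR N + T * projR D) * D = E := by
    intro V U Z W T h1 h2 h3 h4
    have e1 : M† * E * D† * D = M† * E := by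
      calc M† * E * D† * D = M† * (projR A * E * (D† * D)) := by
            rw [← hMR]; simp only [Matrix.mul_assoc, ← Matrix.mul_assoc (projR A) (projR A),
              projR_mul_projR]
        _ = M† * E := by rw [mul_mpInv_mul_of_projL h2, ← Matrix.mul_assoc, hMR]
    have e2 : M * M† * E = projR A * E := by
      calc M * M† * E = M * M† * (projR A * E) := by
            rw [← Matrix.mul_assoc (M * M†), Matrix.mul_assoc M M† (projR A), hMR]
        _ = projR A * E := mul_mpInv_mul_of_projR (by rw [← Matrix.mul_assoc, h1])
    have e3 : E * N† * N = E * projL B := by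
      calc E * N† * N = E * projL B * (N† * N) := by
            rw [← Matrix.mul_assoc, Matrix.mul_assoc E (projL B), hNL]
        _ = _ := mul_mpInv_mul_of_projL h3
    have e4 : C * C† * (E * projL B) = E * projL B :=
      mul_mpInv_mul_of_projR (by rw [← Matrix.mul_assoc, h4])
    -- Apply `C = C M†M + S` to `C† E L_B`, using `C C† E L_B = E L_B`. For the first summand, `M† =
    -- M† R_A` gives `M† E L_B = M† R_A C C† E L_B = M†M C† E L_B`.
    have e5 : C * M† * E * projL B + S * C† * E * projL B = E * projL B := by
      have : C * M† * E * projL B = C * M† * M * (C† * (E * projL B)) := by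
        calc C * M† * E * projL B = C * (M† * projR A) * (E * projL B) := by
              rw [hMR]; simp only [Matrix.mul_assoc]
          _ = C * (M† * projR A) * (C * C† * (E * projL B)) := by rw [e4]
          _ = C * M† * (projR A * C) * (C† * (E * projL B)) := by simp only [Matrix.mul_assoc]
          _ = _ := by rw [← hM]
      rw [Matrix.mul_assoc] at e4
      rw [this, hS, projL.eq_1 M, Matrix.mul_sub, Matrix.mul_one]
      simp only [Matrix.sub_mul, Matrix.mul_assoc]
      rw [e4]
      abel
    have hX : A * (A† * E * B† - A† * S * C† * E * N† * D * B† - A† * C * M† * E * B†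
          - A† * S * V * projR N * D * B† + projL A * U + Z * projR B) * B
        = A * A† * E * (B† * B) - S * C† * E * N† * (D - N) - (C - M) * M† * E * (B† * B)
          - S * V * projR N * (D - N) := by
      have z1 : A * (projL A * U) * B = 0 := by
        rw [← Matrix.mul_assoc, mul_projL_self, Matrix.zero_mul, Matrix.zero_mul]
      have z2 : A * (Z * projR B) * B = 0 := by
        rw [Matrix.mul_assoc, Matrix.mul_assoc, projR_mul_self, Matrix.mul_zero, Matrix.mul_zero]
      rw [Matrix.mul_add, Matrix.mul_add, Matrix.add_mul, Matrix.add_mul, z1, z2, add_zero,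
        add_zero, ← hDB, ← hAC]
      conv_rhs => rw [← hAS]
      simp only [Matrix.mul_sub, Matrix.sub_mul, Matrix.mul_assoc]
    have hY : C * (M† * E * D† + S† * S * C† * E * N† + projL M * projL S * W
          + projL M * V * projR N + T * projR D) * D
        = C * M† * E + S * C† * E * N† * D + S * V * projR N * D := by
      have z1 : C * (projL M * projL S * W) * D = 0 := by
        rw [← Matrix.mul_assoc, ← Matrix.mul_assoc, ← hS, mul_projL_self, Matrix.zero_mul,
          Matrix.zero_mul]
      have z2 : C * (T * projR D) * D = 0 := by
        rw [Matrix.mul_assoc, Matrix.mul_assoc, projR_mul_self, Matrix.mul_zero, Matrix.mul_zero]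
      have z3 : C * (projL M * V * projR N) * D = S * V * projR N * D := by
        rw [hS]; simp only [Matrix.mul_assoc]
      have z4 : C * (S† * S * C† * E * N†) * D = S * C† * E * N† * D := by
        conv_rhs => rw [← hCS]
        simp only [Matrix.mul_assoc]
      have z5 : C * (M† * E * D†) * D = C * M† * E := by
        rw [Matrix.mul_assoc, e1, ← Matrix.mul_assoc]
      simp only [Matrix.mul_add, Matrix.add_mul, z1, z2, z3, z4, z5, add_zero]
    have hR : projR N * N = 0 := projR_mul_self N
    -- On `E` the sum `A A† + M M†` acts as the identity, since `M M† E = R_A E`.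
    have hP : A * A† * E * (B† * B) + M * M† * E * (B† * B) = E - E * projL B := by
      rw [e2, ← Matrix.add_mul, projR, Matrix.sub_mul, Matrix.one_mul, add_sub_cancel, projL,
        Matrix.mul_sub, Matrix.mul_one, sub_sub_cancel]
    have hQ : C * M† * E * (B† * B) = C * M† * E - C * M† * E * projL B := by
      rw [projL, Matrix.mul_sub _ 1, Matrix.mul_one, sub_sub_cancel]
    have hT : S * C† * E * N† * N = S * C† * E * projL B := by
      rw [Matrix.mul_assoc _ E, Matrix.mul_assoc _ (E * _), e3, Matrix.mul_assoc _ E]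
    have hU : S * V * projR N * N = 0 := by rw [Matrix.mul_assoc, hR, Matrix.mul_zero]
    rw [hX, hY, Matrix.mul_sub, Matrix.mul_sub, hT, hU, Matrix.sub_mul, Matrix.sub_mul,
      Matrix.sub_mul, hQ]
    rw [← eq_sub_iff_add_eq] at e5 hP
    rw [hP, e5]
    abel
  constructor
  · intro h
    have h1 : projR A * E = M * Y * D := by
      rw [← h, hM, Matrix.mul_add]
      simp only [← Matrix.mul_assoc]
      rw [projR_mul_self]
      simp only [Matrix.zero_mul, zero_add]
    have h2 : E * projL B = C * Y * N := by
      rw [← h, hN, Matrix.add_mul]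
      simp only [Matrix.mul_assoc]
      rw [mul_projL_self]
      simp only [Matrix.mul_zero, zero_add]
    have c1 : projR M * projR A * E = 0 := by
      rw [Matrix.mul_assoc, h1, ← Matrix.mul_assoc, ← Matrix.mul_assoc, projR_mul_self,
        Matrix.zero_mul, Matrix.zero_mul]
    have c2 : projR A * E * projL D = 0 := by
      rw [h1, Matrix.mul_assoc, mul_projL_self, Matrix.mul_zero]
    have c3 : E * projL B * projL N = 0 := by
      rw [h2, Matrix.mul_assoc, mul_projL_self, Matrix.mul_zero]
    have c4 : projR C * E * projL B = 0 := by
      rw [Matrix.mul_assoc, h2, ← Matrix.mul_assoc, ← Matrix.mul_assoc, projR_mul_self,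
        Matrix.zero_mul, Matrix.zero_mul]
    refine ⟨⟨c1, c2, c3, c4⟩, ?_⟩
    have hMC : M * (C† * C) = M := by
      rw [hM, Matrix.mul_assoc, ← Matrix.mul_assoc C, mul_mpInv_mul]
    have hCM : C† * C * M† = M† := mul_mpInv_of_mul_eq (mpInv_spec C).four hMC
    have hSC : S * (C† * C) = S := by
      rw [hS, projL, Matrix.mul_sub, Matrix.mul_one, Matrix.sub_mul, Matrix.mul_assoc _ _ (C† * C),
        Matrix.mul_assoc _ _ (C† * C), hMC, ← Matrix.mul_assoc, mul_mpInv_mul]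
    have y1 : M† * E * D† = M† * M * Y * (D * D†) := by
      rw [← hMR, Matrix.mul_assoc _ _ E, h1, hMR]
      simp only [Matrix.mul_assoc]
    have y2 : S† * S * C† * E * N† = S† * S * Y * (N * N†) := by
      calc S† * S * C† * E * N† = S† * S * C† * (E * projL B) * N† := by
            conv_lhs => rw [← hNL]
            simp only [Matrix.mul_assoc]
        _ = S† * (S * (C† * C)) * Y * (N * N†) := by rw [h2]; simp only [Matrix.mul_assoc]
        _ = _ := by rw [hSC]
    -- Since `L_M S† = S†`, the projections `M†M` and `S†S` are orthogonal, and `Y` splits into its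
    -- `M†M`, `S†S` and `L_M L_S` parts. The data determine `M†M Y D D†` and `S†S Y N N†`; the
    -- parameters `T = M†M Y` and `V = S†S Y` supply the complements along `R_D` and `R_N`.
    have hY : Y = M† * E * D† + S† * S * C† * E * N† + projL M * projL S * Y
          + projL M * (S† * S * Y) * projR N + M† * M * Y * projR D := by
      have y3 : projL M * (S† * S * Y) = S† * S * Y := by
        simp only [← Matrix.mul_assoc]; rw [hSL]
      have y4 : projL M * projL S * Y = Y - M† * M * Y - S† * S * Y := by
        conv_lhs => rw [projL.eq_1 S, Matrix.mul_sub, ← Matrix.mul_assoc, hSL]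
        rw [projL]
        simp only [Matrix.sub_mul, Matrix.mul_one, Matrix.one_mul]
      rw [y3, y1, y2, y4, projR, projR, Matrix.mul_sub _ 1, Matrix.mul_sub _ 1, Matrix.mul_one,
        Matrix.mul_one]
      abel
    -- With `U = Z = 0` this produces a solution having the same `Y`. The two values of `X` then
    -- differ by a solution of `A X B = 0`.
    have h3 := sound (S† * S * Y) 0 0 Y (M† * M * Y) c1 c2 c3 c4
    rw [← hY, Matrix.mul_zero, Matrix.zero_mul, add_zero, add_zero] at h3
    have h4 := sub_eq_zero.2 (add_right_cancel (h.trans h3.symm))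
    rw [← Matrix.sub_mul, ← Matrix.mul_sub] at h4
    obtain ⟨U, Z, hUZ⟩ := exists_of_mul_mul_eq_zero h4
    refine ⟨S† * S * Y, U, Z, Y, M† * M * Y, ?_, hY⟩
    rw [add_assoc, ← hUZ, add_sub_cancel]
  · rintro ⟨⟨h1, h2, h3, h4⟩, V, U, Z, W, T, rfl, rfl⟩
    exact sound V U Z W T h1 h2 h3 h4

/-- The general solution of `A X B - C Y D = E`. -/
theorem two_term_sub_iff {A : Matrix m n ℍ[ℝ]} {B : Matrix k l ℍ[ℝ]} {C : Matrix m p ℍ[ℝ]}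
    {D : Matrix q l ℍ[ℝ]} {E : Matrix m l ℍ[ℝ]} {M S : Matrix m p ℍ[ℝ]} {N : Matrix q l ℍ[ℝ]}
    (hM : M = projR A * C) (hN : N = D * projL B) (hS : S = C * projL M)
    {X : Matrix n k ℍ[ℝ]} {Y : Matrix p q ℍ[ℝ]} :
    A * X * B - C * Y * D = E ↔
      (projR M * projR A * E = 0 ∧ projR A * E * projL D = 0 ∧ E * projL B * projL N = 0 ∧
        projR C * E * projL B = 0) ∧
      ∃ (V : Matrix p q ℍ[ℝ]) (U Z : Matrix n k ℍ[ℝ]) (W T : Matrix p q ℍ[ℝ]),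
        X = A† * E * B† - A† * S * C† * E * N† * D * B† - A† * C * M† * E * B†
          + A† * S * V * projR N * D * B† + projL A * U + Z * projR B ∧
        Y = -(M† * E * D†) - S† * S * C† * E * N† + projL M * projL S * W
          + projL M * V * projR N + T * projR D := by
  -- The sign of `Y` is absorbed into the parameters `V`, `W`, `T`.
  have h := two_term_iff (E := E) hM hN hS (X := X) (Y := -Y)
  rw [Matrix.mul_neg, Matrix.neg_mul, ← sub_eq_add_neg] at h
  rw [h]
  refine and_congr_right fun _ => ⟨?_, ?_⟩
  · rintro ⟨V, U, Z, W, T, hX, hY⟩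
    refine ⟨-V, U, Z, -W, -T, ?_, ?_⟩
    · rw [hX]
      simp only [Matrix.mul_neg, Matrix.neg_mul, sub_eq_add_neg]
    · rw [← neg_neg Y, hY]
      simp only [Matrix.mul_neg, Matrix.neg_mul]
      abel
  · rintro ⟨V, U, Z, W, T, hX, hY⟩
    refine ⟨-V, U, Z, -W, -T, ?_, ?_⟩
    · rw [hX]
      simp only [Matrix.mul_neg, Matrix.neg_mul, sub_neg_eq_add]
    · rw [hY]
      simp only [Matrix.mul_neg, Matrix.neg_mul]
      abel

end Equations

/-! ### The `η`-conjugate transpose -/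

section EtaConj

variable {m n k : Type} {η : ℍ[ℝ]}

theorem IsBasisUnit.star_eq (h : IsBasisUnit η) : star η = -η := by
  rw [Quaternion.star_eq_neg]
  rcases h with rfl | rfl | rfl <;> rfl

theorem IsBasisUnit.mul_self (h : IsBasisUnit η) : η * η = -1 := by
  have h1 : Quaternion.normSq η = 1 := by
    rw [Quaternion.normSq_def']
    rcases h with rfl | rfl | rfl <;> norm_num
  have h2 := Quaternion.self_mul_star η
  rw [h.star_eq, h1, mul_neg, Quaternion.coe_one] at h2
  rw [← h2, neg_neg]

theorem etaConj_apply (A : Matrix m n ℍ[ℝ]) (i : n) (j : m) :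
    etaConj η A i j = -(η * star (A j i) * η) := rfl

theorem etaConj_add (A B : Matrix m n ℍ[ℝ]) :
    etaConj η (A + B) = etaConj η A + etaConj η B := by
  ext1 i j
  simp only [etaConj_apply, Matrix.add_apply, star_add, mul_add, add_mul, neg_add]

theorem etaConj_neg (A : Matrix m n ℍ[ℝ]) : etaConj η (-A) = -etaConj η A := by
  ext1 i j
  simp only [etaConj_apply, Matrix.neg_apply, star_neg, mul_neg, neg_mul]

theorem etaConj_sub (A B : Matrix m n ℍ[ℝ]) :
    etaConj η (A - B) = etaConj η A - etaConj η B := by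
  rw [sub_eq_add_neg, etaConj_add, etaConj_neg, ← sub_eq_add_neg]

theorem etaConj_smul (r : ℝ) (A : Matrix m n ℍ[ℝ]) :
    etaConj η (r • A) = r • etaConj η A := by
  ext1 i j
  simp only [etaConj_apply, Matrix.smul_apply, Quaternion.star_smul, mul_smul_comm,
    smul_mul_assoc, smul_neg]

theorem etaConj_zero : etaConj η (0 : Matrix m n ℍ[ℝ]) = 0 := by
  ext1 i j
  simp [etaConj_apply]

theorem etaConj_one [DecidableEq m] (h : IsBasisUnit η) :
    etaConj η (1 : Matrix m m ℍ[ℝ]) = 1 := by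
  ext1 i j
  rw [etaConj_apply, Matrix.one_apply, Matrix.one_apply]
  rcases eq_or_ne i j with rfl | hij
  · simp [h.mul_self]
  · simp [hij, hij.symm]

theorem etaConj_etaConj (h : IsBasisUnit η) (A : Matrix m n ℍ[ℝ]) :
    etaConj η (etaConj η A) = A := by
  ext1 i j
  rw [etaConj_apply, etaConj_apply, star_neg, StarMul.star_mul, StarMul.star_mul, star_star,
    h.star_eq]
  calc -(η * -(-η * (A i j * -η)) * η) = η * η * A i j * (η * η) := by
        simp only [neg_mul, mul_neg, neg_neg, mul_assoc]
    _ = A i j := by rw [h.mul_self]; simp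

/-- Inserting `η * η = -1` between the two conjugated factors supplies each with its own `-η · η`.
-/
theorem etaConj_mul [Fintype n] (h : IsBasisUnit η) (A : Matrix m n ℍ[ℝ]) (B : Matrix n k ℍ[ℝ]) :
    etaConj η (A * B) = etaConj η B * etaConj η A := by
  ext1 i j
  rw [etaConj_apply, Matrix.mul_apply, Matrix.mul_apply, star_sum, Finset.mul_sum,
    Finset.sum_mul, ← Finset.sum_neg_distrib]
  refine Finset.sum_congr rfl fun x _ => ?_
  rw [etaConj_apply, etaConj_apply, StarMul.star_mul]
  calc -(η * (star (B x i) * star (A j x)) * η)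
      = η * star (B x i) * (η * η) * star (A j x) * η := by
        rw [h.mul_self]; simp only [mul_neg, neg_mul, mul_one, mul_assoc]
    _ = _ := by simp only [mul_neg, neg_mul, neg_neg, mul_assoc]

theorem etaConj_conjTranspose (h : IsBasisUnit η) (A : Matrix m n ℍ[ℝ]) :
    etaConj η Aᴴ = (etaConj η A)ᴴ := by
  ext1 i j
  rw [etaConj_apply, Matrix.conjTranspose_apply, Matrix.conjTranspose_apply, etaConj_apply,
    star_neg, StarMul.star_mul, StarMul.star_mul, star_star, h.star_eq]
  simp only [mul_neg, neg_mul, neg_neg, mul_assoc]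

variable [Fintype m] [Fintype n] [DecidableEq m] [DecidableEq n]

/-- By uniqueness of the Moore-Penrose inverse: `η`-conjugation reverses products and commutes with
`ᴴ`, so it exchanges the two Hermitian Penrose equations. -/
theorem etaConj_mpInv (h : IsBasisUnit η) (A : Matrix m n ℍ[ℝ]) :
    etaConj η A† = (etaConj η A)† := by
  refine IsMoorePenrose.unique (A := etaConj η A) ⟨?_, ?_, ?_, ?_⟩ (mpInv_spec _)
  · rw [← etaConj_mul h, ← etaConj_mul h, ← Matrix.mul_assoc, mul_mpInv_mul]
  · rw [← etaConj_mul h, ← etaConj_mul h, ← Matrix.mul_assoc, mpInv_mul_mpInv]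
  · rw [← etaConj_mul h, ← etaConj_conjTranspose h, (mpInv_spec A).four]
  · rw [← etaConj_mul h, ← etaConj_conjTranspose h, (mpInv_spec A).three]

theorem etaConj_projL (h : IsBasisUnit η) (A : Matrix m n ℍ[ℝ]) :
    etaConj η (projL A) = projR (etaConj η A) := by
  rw [projL, projR, etaConj_sub, etaConj_one h, etaConj_mul h, etaConj_mpInv h]

theorem etaConj_projR (h : IsBasisUnit η) (A : Matrix m n ℍ[ℝ]) :
    etaConj η (projR A) = projL (etaConj η A) := by
  rw [projL, projR, etaConj_sub, etaConj_one h, etaConj_mul h, etaConj_mpInv h]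

end EtaConj

/-! ### Block tensors and Sylvester equations with block coefficients -/

section Blocks

variable {N M : ℕ}

/-- The embedding of the multi-indices of the first block. -/
def blockInl {J : Fin M → ℕ} (K : Fin M → ℕ) (j : MIdx J) : MIdx (J + K) :=
  fun s => ⟨(j s).val, Nat.lt_add_right (K s) (j s).isLt⟩

/-- The embedding of the multi-indices of the second block. -/
def blockInr (J : Fin M → ℕ) {K : Fin M → ℕ} (k : MIdx K) : MIdx (J + K) :=
  fun s => ⟨J s + (k s).val, Nat.add_lt_add_left (k s).isLt (J s)⟩

/-- The block tensor `(0 I)`. -/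
noncomputable def selRow' (J K : Fin M → ℕ) : Tensor K (J + K) := rowBlock (0 : Tensor K J) (1 : Tensor K K)

/-- The block tensor with `0` on top of `I`. -/
noncomputable def selCol' (J K : Fin M → ℕ) : Tensor (J + K) K := colBlock (0 : Tensor J K) (1 : Tensor K K)

variable {I : Fin N → ℕ} {J K : Fin M → ℕ}

/-- All block algebra is reduced to the four products of a row selector with a column selector. The
selectors need not add up to the identity of `J + K`: a multi-index with some coordinates in the
first range and some in the second belongs to neither block. -/
theorem rowBlock_eq (A : Tensor I J) (B : Tensor I K) :
    rowBlock A B = A * selRow J K + B * selRow' J K := by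
  ext1 i l
  rw [Matrix.add_apply, Matrix.mul_apply, Matrix.mul_apply]
  simp only [rowBlock, selRow, selRow', Matrix.of_apply, Matrix.zero_apply]
  split_ifs with h h'
  · simp [Matrix.one_apply]
  · simp [Matrix.one_apply]
  · simp

theorem colBlock_eq (A : Tensor J I) (B : Tensor K I) :
    colBlock A B = selCol J K * A + selCol' J K * B := by
  ext1 l i
  rw [Matrix.add_apply, Matrix.mul_apply, Matrix.mul_apply]
  simp only [colBlock, selCol, selCol', Matrix.of_apply, Matrix.zero_apply]
  split_ifs with h h'
  · simp [Matrix.one_apply]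
  · simp [Matrix.one_apply]
  · simp

theorem blockInl_injective : Function.Injective (blockInl (J := J) K) := by
  intro a b h
  funext s
  have h1 : (blockInl K a s).val = (blockInl K b s).val := by rw [h]
  exact Fin.ext h1

theorem blockInr_injective : Function.Injective (blockInr J (K := K)) := by
  intro a b h
  funext s
  exact Fin.ext (Nat.add_left_cancel (congrArg Fin.val (congrFun h s)))

/-- One coordinate suffices to separate the blocks. For `M = 0` both would consist of the empty
multi-index. -/
theorem blockInl_ne_blockInr (hM : 0 < M) (a : MIdx J) (b : MIdx K) :
    blockInl K a ≠ blockInr J b := by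
  intro h
  have h1 : (a ⟨0, hM⟩).val = J ⟨0, hM⟩ + (b ⟨0, hM⟩).val :=
    congrArg Fin.val (congrFun h ⟨0, hM⟩)
  have h2 := (a ⟨0, hM⟩).isLt
  omega

theorem selRow_apply (j : MIdx J) (l : MIdx (J + K)) :
    selRow J K j l = if l = blockInl K j then 1 else 0 := by
  simp only [selRow, rowBlock, Matrix.of_apply, Matrix.zero_apply, Matrix.one_apply, dite_eq_ite,
    ite_self]
  by_cases h : ∀ s, (l s).val < J s
  · rw [dif_pos h]
    refine if_congr ⟨fun e => ?_, fun e => ?_⟩ rfl rfl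
    · subst e; rfl
    · subst e; rfl
  · rw [dif_neg h, if_neg]
    rintro rfl
    exact h fun s => (j s).isLt

theorem selRow'_apply (hM : 0 < M) (k : MIdx K) (l : MIdx (J + K)) :
    selRow' J K k l = if l = blockInr J k then 1 else 0 := by
  simp only [selRow', rowBlock, Matrix.of_apply, Matrix.zero_apply, Matrix.one_apply]
  by_cases h : ∀ s, (l s).val < J s
  · rw [dif_pos h, if_neg]
    rintro rfl
    have h1 : J ⟨0, hM⟩ + (k ⟨0, hM⟩).val < J ⟨0, hM⟩ := h ⟨0, hM⟩
    omega
  rw [dif_neg h]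
  by_cases h' : ∀ s, J s ≤ (l s).val
  · rw [dif_pos h']
    refine if_congr ⟨fun e => ?_, fun e => ?_⟩ rfl rfl
    · subst e
      funext s
      exact Fin.ext (Nat.add_sub_cancel' (h' s)).symm
    · subst e
      funext s
      exact Fin.ext (Nat.add_sub_cancel_left (J s) _).symm
  · rw [dif_neg h', if_neg]
    rintro rfl
    exact h' fun s => Nat.le_add_right _ _

theorem selCol_eq : selCol J K = (selRow J K)ᵀ := by
  ext1 l j
  simp only [selCol, selRow, colBlock, rowBlock, Matrix.of_apply, Matrix.transpose_apply,
    Matrix.zero_apply, Matrix.one_apply, eq_comm]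

theorem selCol'_eq : selCol' J K = (selRow' J K)ᵀ := by
  ext1 l j
  simp only [selCol', selRow', colBlock, rowBlock, Matrix.of_apply, Matrix.transpose_apply,
    Matrix.zero_apply, Matrix.one_apply, eq_comm]

theorem selRow_mul_selCol : selRow J K * selCol J K = 1 := by
  ext1 i j
  rw [Matrix.mul_apply]
  simp only [selCol_eq, Matrix.transpose_apply, selRow_apply, ite_mul, one_mul, zero_mul,
    Finset.sum_ite_eq', Finset.mem_univ, if_true, Matrix.one_apply,
    blockInl_injective.eq_iff]

theorem selRow_mul_selCol' (hM : 0 < M) : selRow J K * selCol' J K = 0 := by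
  ext1 i j
  rw [Matrix.mul_apply]
  simp [selCol'_eq, selRow_apply, selRow'_apply hM, (blockInl_ne_blockInr hM _ _).symm]

theorem selRow'_mul_selCol (hM : 0 < M) : selRow' J K * selCol J K = 0 := by
  ext1 i j
  rw [Matrix.mul_apply]
  simp [selCol_eq, selRow_apply, selRow'_apply hM, blockInl_ne_blockInr hM]

theorem selRow'_mul_selCol' (hM : 0 < M) : selRow' J K * selCol' J K = 1 := by
  ext1 i j
  rw [Matrix.mul_apply]
  simp only [selCol'_eq, Matrix.transpose_apply, selRow'_apply hM, ite_mul, one_mul, zero_mul,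
    Finset.sum_ite_eq', Finset.mem_univ, if_true, Matrix.one_apply,
    blockInr_injective.eq_iff]

theorem etaConj_rowBlock {η : ℍ[ℝ]} (A : Tensor I J) (B : Tensor I K) :
    etaConj η (rowBlock A B) = colBlock (etaConj η A) (etaConj η B) := by
  ext1 l i
  simp only [etaConj_apply, rowBlock, colBlock, Matrix.of_apply]
  split_ifs <;> simp

variable {L : Fin M → ℕ} {O O' : Fin M → ℕ}

/-- Only the first blocks `x`, `y` are prescribed; the second blocks are quantified away. Mixed
multi-indices do no harm: the coefficient blocks vanish there, so the corresponding entries of `X`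
and `Y` do not enter the equation. -/
theorem exists_block_sylvester_iff (hM : 0 < M) {A₁ : Tensor I J} {A₂ : Tensor I K}
    {B₁ : Tensor O L} {B₂ : Tensor O' L} {C : Tensor I L} {x : Tensor J L} {y : Tensor I O} :
    (∃ (x' : Tensor K L) (y' : Tensor I O'), A₁ * x + A₂ * x' + y * B₁ + y' * B₂ = C) ↔
      ∃ (X : Tensor (J + K) L) (Y : Tensor I (O + O')),
        rowBlock A₁ A₂ * X + Y * colBlock B₁ B₂ = C ∧ x = selRow J K * X ∧
          y = Y * selCol O O' := by
  constructor
  · rintro ⟨x', y', rfl⟩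
    refine ⟨colBlock x x', rowBlock y y', ?_, ?_, ?_⟩
    -- This one product formula serves both `rowBlock A₁ A₂ * colBlock x x'` and `rowBlock y y' *
    -- colBlock B₁ B₂`.
    · have key : ∀ {R : Fin N → ℕ} {J K T : Fin M → ℕ} (a : Tensor R J) (b : Tensor R K)
          (c : Tensor J T) (d : Tensor K T), rowBlock a b * colBlock c d = a * c + b * d := by
        intro R J K T a b c d
        calc rowBlock a b * colBlock c d
            = a * (selRow J K * selCol J K) * c + a * (selRow J K * selCol' J K) * d
              + (b * (selRow' J K * selCol J K) * c + b * (selRow' J K * selCol' J K) * d) := by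
              rw [rowBlock_eq, colBlock_eq]
              simp only [Matrix.mul_add, Matrix.add_mul, Matrix.mul_assoc]
              abel
          _ = a * c + b * d := by
              rw [selRow_mul_selCol, selRow_mul_selCol' hM, selRow'_mul_selCol hM,
                selRow'_mul_selCol' hM]
              simp only [Matrix.mul_zero, Matrix.zero_mul, Matrix.mul_one, add_zero, zero_add]
      rw [key, key]
      abel
    · rw [colBlock_eq, Matrix.mul_add, ← Matrix.mul_assoc, ← Matrix.mul_assoc,
        selRow_mul_selCol, selRow_mul_selCol' hM, Matrix.one_mul, Matrix.zero_mul, add_zero]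
    · rw [rowBlock_eq, Matrix.add_mul, Matrix.mul_assoc, Matrix.mul_assoc,
        selRow_mul_selCol, selRow'_mul_selCol hM, Matrix.mul_one, Matrix.mul_zero, add_zero]
  · rintro ⟨X, Y, rfl, rfl, rfl⟩
    refine ⟨selRow' J K * X, Y * selCol' O O', ?_⟩
    rw [rowBlock_eq, colBlock_eq]
    simp only [Matrix.mul_add, Matrix.add_mul, Matrix.mul_assoc]
    abel

/-- The form used for `V1` and `V3`; relative to `sylvester_iff` the signs of `T` and `V` are
reversed. -/
theorem block_sylvester_iff (hM : 0 < M) {A₁ : Tensor I J} {A₂ : Tensor I K}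
    {B₁ : Tensor O L} {B₂ : Tensor O' L} {C : Tensor I L} {x : Tensor J L} {y : Tensor I O}
    {A : Tensor I (J + K)} {B : Tensor (O + O') L} (hA : A = rowBlock A₁ A₂)
    (hB : B = colBlock B₁ B₂) :
    (∃ (x' : Tensor K L) (y' : Tensor I O'), A₁ * x + A₂ * x' + y * B₁ + y' * B₂ = C) ↔
      projR A * C * projL B = 0 ∧
        ∃ (T : Tensor (J + K) (O + O')) (U : Tensor (J + K) L) (V : Tensor I (O + O')),
          x = selRow J K * (A† * C + T * B + projL A * U) ∧
          y = (projR A * C * B† - A * T - V * projR B) * selCol O O' := by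
  rw [exists_block_sylvester_iff hM, ← hA, ← hB]
  constructor
  · rintro ⟨X, Y, h, rfl, rfl⟩
    obtain ⟨hC, T, U, V, rfl, rfl⟩ := sylvester_iff.1 h
    refine ⟨hC, -T, U, -V, ?_, ?_⟩
    · rw [Matrix.neg_mul, ← sub_eq_add_neg]
    · rw [Matrix.mul_neg, Matrix.neg_mul, sub_neg_eq_add, sub_neg_eq_add]
  · rintro ⟨hC, T, U, V, rfl, rfl⟩
    refine ⟨_, _, sylvester_iff.2 ⟨hC, -T, U, -V, rfl, rfl⟩, ?_, ?_⟩
    · rw [Matrix.neg_mul, sub_neg_eq_add]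
    · rw [Matrix.mul_neg, Matrix.neg_mul, ← sub_eq_add_neg, ← sub_eq_add_neg]

/-- The form with `A† T B` and `A A† T`, used in all the other matchings. -/
theorem block_sylvester_iff' (hM : 0 < M) {A₁ : Tensor I J} {A₂ : Tensor I K}
    {B₁ : Tensor O L} {B₂ : Tensor O' L} {C : Tensor I L} {x : Tensor J L} {y : Tensor I O}
    {A : Tensor I (J + K)} {B : Tensor (O + O') L} (hA : A = rowBlock A₁ A₂)
    (hB : B = colBlock B₁ B₂) :
    (∃ (x' : Tensor K L) (y' : Tensor I O'), A₁ * x + A₂ * x' + y * B₁ + y' * B₂ = C) ↔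
      projR A * C * projL B = 0 ∧
        ∃ (T : Tensor I (O + O')) (U : Tensor (J + K) L) (V : Tensor I (O + O')),
          x = selRow J K * (A† * C - A† * T * B + projL A * U) ∧
          y = (projR A * C * B† + A * A† * T + V * projR B) * selCol O O' := by
  rw [exists_block_sylvester_iff hM, ← hA, ← hB]
  constructor
  · rintro ⟨X, Y, h, rfl, rfl⟩
    obtain ⟨hC, T, U, V, rfl, rfl⟩ := sylvester_iff'.1 h
    exact ⟨hC, T, U, V, rfl, rfl⟩
  · rintro ⟨hC, T, U, V, rfl, rfl⟩
    exact ⟨_, _, sylvester_iff'.2 ⟨hC, T, U, V, rfl, rfl⟩, rfl, rfl⟩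

end Blocks

/-! ### Matching two parametrizations of one unknown -/

section Merge

variable {m n k l p q : Type} [Fintype n] [Fintype k] [Fintype p] [Fintype q]

/-- Comparing two parametrizations `P₁ + L₁ x + y R₁` and `P₂ + L₂ u + z R₂`. -/
theorem exists_param_eq_iff {P₁ P₂ : Matrix m l ℍ[ℝ]} {L₁ : Matrix m n ℍ[ℝ]}
    {L₂ : Matrix m p ℍ[ℝ]} {R₁ : Matrix k l ℍ[ℝ]} {R₂ : Matrix q l ℍ[ℝ]} {x : Matrix n l ℍ[ℝ]}
    {y : Matrix m k ℍ[ℝ]} :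
    (∃ (u : Matrix p l ℍ[ℝ]) (z : Matrix m q ℍ[ℝ]),
      P₁ + L₁ * x + y * R₁ = P₂ + L₂ * u + z * R₂) ↔
    ∃ (x' : Matrix p l ℍ[ℝ]) (y' : Matrix m q ℍ[ℝ]),
      L₁ * x + L₂ * x' + y * R₁ + y' * R₂ = P₂ - P₁ := by
  constructor
  · rintro ⟨u, z, h⟩
    refine ⟨-u, -z, ?_⟩
    rw [← sub_eq_zero] at h ⊢
    rw [← h, Matrix.mul_neg, Matrix.neg_mul]
    abel
  · rintro ⟨u, z, h⟩
    refine ⟨-u, -z, ?_⟩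
    rw [← sub_eq_zero] at h ⊢
    rw [← h, Matrix.mul_neg, Matrix.neg_mul]
    abel

/-- Here the minus signs stay in the coefficients, which is why `Atilde` and `Btilde` carry a sign
in their second block. -/
theorem exists_param_eq_iff' {P₁ P₂ : Matrix m l ℍ[ℝ]} {L₁ : Matrix m n ℍ[ℝ]}
    {L₂ : Matrix m p ℍ[ℝ]} {R₁ : Matrix k l ℍ[ℝ]} {R₂ : Matrix q l ℍ[ℝ]} {x : Matrix n l ℍ[ℝ]}
    {y : Matrix m k ℍ[ℝ]} :
    (∃ (u : Matrix p l ℍ[ℝ]) (z : Matrix m q ℍ[ℝ]),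
      P₁ - L₁ * x - y * R₁ = P₂ - L₂ * u - z * R₂) ↔
    ∃ (x' : Matrix p l ℍ[ℝ]) (y' : Matrix m q ℍ[ℝ]),
      L₁ * x + (-L₂) * x' + y * R₁ + y' * (-R₂) = P₁ - P₂ := by
  refine exists_congr fun u => exists_congr fun z => ?_
  rw [← sub_eq_zero, ← neg_eq_zero, ← sub_eq_zero (b := P₁ - P₂)]
  refine Eq.congr ?_ rfl
  rw [Matrix.mul_neg, Matrix.neg_mul]
  abel

end Merge

/-! ### The system: conjugation rules and the single elimination steps -/

namespace Coeffs

variable {N : ℕ} {dI dJ dQ dP dE dR : Fin N → ℕ} (S : Coeffs dI dJ dQ dP dE dR)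

section Ec

variable {m n k : Type}

theorem ec_add (A B : Matrix m n ℍ[ℝ]) : S.ec (A + B) = S.ec A + S.ec B := etaConj_add A B

variable {S}

theorem ec_ec (hη : IsBasisUnit S.η) (A : Matrix m n ℍ[ℝ]) : S.ec (S.ec A) = A :=
  etaConj_etaConj hη A

theorem ec_mul [Fintype n] (hη : IsBasisUnit S.η) (A : Matrix m n ℍ[ℝ]) (B : Matrix n k ℍ[ℝ]) :
    S.ec (A * B) = S.ec B * S.ec A :=
  etaConj_mul hη A B

variable [Fintype m] [Fintype n] [DecidableEq m] [DecidableEq n]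

theorem ec_mpInv (hη : IsBasisUnit S.η) (A : Matrix m n ℍ[ℝ]) : S.ec A† = (S.ec A)† :=
  etaConj_mpInv hη A

theorem ec_projL (hη : IsBasisUnit S.η) (A : Matrix m n ℍ[ℝ]) :
    S.ec (projL A) = projR (S.ec A) :=
  etaConj_projL hη A

theorem ec_projR (hη : IsBasisUnit S.η) (A : Matrix m n ℍ[ℝ]) :
    S.ec (projR A) = projL (S.ec A) :=
  etaConj_projR hη A

end Ec

/-! ### Elimination of the unknowns, one at a time -/

variable {S}

/-- This identifies `S.ec S.M1` as the tensor `N` of `two_term_iff` for the equation with right-hand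
side `G`. -/
theorem ec_M1 (hη : IsBasisUnit S.η) : S.ec S.M1 = S.ec S.C6 * projL (S.ec S.Ahat4) := by
  rw [M1, ec_mul hη, ec_projR hη]

/-- A Sylvester equation in `X11`, `X12`, whose solvability condition is the equation multiplied by
`projR S.A6` on the left and its conjugate on the right. This condition involves only `X` and `W`,
so `X11` and `X12` may later be changed without touching it. -/
theorem eq9_iff (hη : IsBasisUnit S.η) {X11 : Tensor dE dI} {X12 : Tensor dI dE}
    {X : Tensor dJ dJ} {W : Tensor dP dP} :
    S.A6 * X11 + X12 * S.ec S.A6 + S.C3 * X * S.ec S.C3 + S.C4 * W * S.ec S.C4 = S.E9 ↔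
      S.Ahat4 * X * S.ec S.Ahat4 + S.Chat4 * W * S.ec S.Chat4 = S.Phat ∧
      ∃ (T : Tensor dE dE) (T3 : Tensor dI dE) (T4 : Tensor dE dI),
        X11 = S.A6† * S.Egrave1 X W - T * S.ec S.A6 + projL S.A6 * T4 ∧
        X12 = projR S.A6 * S.Egrave1 X W * S.ec S.A6† + S.A6 * T + T3 * projR (S.ec S.A6) := by
  have h1 : S.A6 * X11 + X12 * S.ec S.A6 + S.C3 * X * S.ec S.C3 + S.C4 * W * S.ec S.C4 = S.E9 ↔
      S.A6 * X11 + X12 * S.ec S.A6 = S.Egrave1 X W := by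
    rw [Egrave1, eq_sub_iff_add_eq, eq_sub_iff_add_eq, add_right_comm _ (S.C4 * _ * _)]
  have h2 : projR S.A6 * S.Egrave1 X W * projL (S.ec S.A6) = 0 ↔
      S.Ahat4 * X * S.ec S.Ahat4 + S.Chat4 * W * S.ec S.Chat4 = S.Phat := by
    rw [eq_comm (b := S.Phat), ← sub_eq_zero (a := S.Phat), Ahat4, Chat4, Phat, Egrave1,
      ec_mul hη, ec_mul hη, ec_projR hη]
    simp only [Matrix.mul_sub, Matrix.sub_mul, Matrix.mul_assoc, Matrix.mul_add,
      Matrix.add_mul, sub_sub]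
  rw [h1, sylvester_iff, h2, ec_mpInv hη]
  refine and_congr_right fun _ => exists_congr fun T => ?_
  rw [exists_comm]

theorem eq3_iff (hη : IsBasisUnit S.η) {W : Tensor dP dP} :
    (S.A3 * W = S.E3 ∧ W * S.ec S.A3 = S.ec S.E3) ↔
      projR S.A3 * S.E3 = 0 ∧ S.A3 * S.ec S.E3 = S.ec (S.A3 * S.ec S.E3) ∧
      ∃ U : Tensor dP dP, W = S.A3† * S.E3 + projL S.A3 * S.ec S.E3 * S.ec S.A3†
        + projL S.A3 * U * projR (S.ec S.A3) := by
  rw [ec_mul hη, ec_ec hη, ec_mpInv hη]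
  constructor
  · rintro ⟨h1, h2⟩
    -- The solution `W` itself serves as the parameter `U`: the first two terms of the formula are
    -- the parts `A3†A3 W` and `L W (1 - R)` of `W`, and the last one is `L W R`.
    refine ⟨?_, ?_, W, ?_⟩
    · rw [← h1, ← Matrix.mul_assoc, projR_mul_self, Matrix.zero_mul]
    · rw [← h2, ← Matrix.mul_assoc, h1]
    · rw [← h2, ← h1, projL, projR, Matrix.mul_sub _ 1, Matrix.mul_one, Matrix.sub_mul]
      simp only [Matrix.sub_mul, Matrix.one_mul, Matrix.mul_assoc]
      abel
  · rintro ⟨h1, h2, U, rfl⟩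
    have h3 : S.ec S.E3 * projL (S.ec S.A3) = 0 := by
      have := congrArg S.ec h1
      rw [ec_mul hη, ec_projR hη] at this
      rw [this]
      exact etaConj_zero
    constructor
    · rw [Matrix.mul_add, Matrix.mul_add, ← Matrix.mul_assoc, ← Matrix.mul_assoc,
        ← Matrix.mul_assoc, ← Matrix.mul_assoc, ← Matrix.mul_assoc, mul_projL_self,
        mul_mpInv_mul_of_projR h1]
      simp only [Matrix.zero_mul, add_zero]
    · rw [Matrix.add_mul, Matrix.add_mul, Matrix.mul_assoc _ (projR _), projR_mul_self,
        Matrix.mul_zero, add_zero, Matrix.mul_assoc _ (S.ec S.A3)†, Matrix.mul_assoc (projL _),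
        mul_mpInv_mul_of_projL h3, projL, Matrix.sub_mul, Matrix.one_mul, Matrix.mul_assoc,
        Matrix.mul_assoc, h2]
      abel

theorem eq_Phat_iff (hη : IsBasisUnit S.η) {X : Tensor dJ dJ} {U W : Tensor dP dP}
    (hW : W = S.A3† * S.E3 + projL S.A3 * S.ec S.E3 * S.ec S.A3†
        + projL S.A3 * U * projR (S.ec S.A3)) :
    S.Ahat4 * X * S.ec S.Ahat4 + S.Chat4 * W * S.ec S.Chat4 = S.Phat ↔
      S.Ahat4 * X * S.ec S.Ahat4 + S.C6 * U * S.ec S.C6 = S.G := by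
  rw [hW, G, C6, ec_mul hη, ec_projL hη, eq_sub_iff_add_eq, eq_sub_iff_add_eq]
  refine Eq.congr ?_ rfl
  simp only [Matrix.mul_add, Matrix.add_mul, Matrix.mul_assoc]
  abel

/-- `two_term_iff` with its shared parameter named `V2`. Once `V2` is fixed, the remaining
parameters of `X` and of `U` are independent, so the two formulas can be treated separately. -/
theorem eq_G_iff (hη : IsBasisUnit S.η) {X : Tensor dJ dJ} {U : Tensor dP dP} :
    S.Ahat4 * X * S.ec S.Ahat4 + S.C6 * U * S.ec S.C6 = S.G ↔
      (projR S.Ahat4 * S.G * projL (S.ec S.C6) = 0 ∧ projR S.C6 * S.G * projL (S.ec S.Ahat4) = 0 ∧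
        projR S.M1 * projR S.Ahat4 * S.G = 0 ∧
        S.G * projL (S.ec S.Ahat4) * projL (S.ec S.M1) = 0) ∧
      ∃ V2 : Tensor dP dP,
        (∃ a b : Tensor dJ dJ,
          X = S.Ahat4† * S.G * (S.ec S.Ahat4)†
            - S.Ahat4† * S.S1 * S.C6† * S.G * (S.ec S.M1)† * S.ec S.C6 * (S.ec S.Ahat4)†
            - S.Ahat4† * S.C6 * S.M1† * S.G * (S.ec S.Ahat4)†
            - S.Ahat4† * S.S1 * V2 * projR (S.ec S.M1) * S.ec S.C6 * (S.ec S.Ahat4)†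
            + projL S.Ahat4 * a + b * projR (S.ec S.Ahat4)) ∧
        ∃ V1 V3 : Tensor dP dP,
          U = S.M1† * S.G * (S.ec S.C6)† + S.S1† * S.S1 * S.C6† * S.G * (S.ec S.M1)†
            + projL S.M1 * projL S.S1 * V1 + projL S.M1 * V2 * projR (S.ec S.M1)
            + V3 * projR (S.ec S.C6) := by
  rw [two_term_iff (M := S.M1) (N := S.ec S.M1) (S := S.S1) rfl (ec_M1 hη) rfl]
  refine and_congr ?_ (exists_congr fun V2 => ?_)
  · exact ⟨fun ⟨h1, h2, h3, h4⟩ => ⟨h2, h4, h1, h3⟩, fun ⟨h1, h2, h3, h4⟩ => ⟨h3, h1, h4, h2⟩⟩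
  · constructor
    · rintro ⟨a, b, V1, V3, hX, hU⟩
      exact ⟨⟨a, b, hX⟩, V1, V3, hU⟩
    · rintro ⟨⟨a, b, hX⟩, V1, V3, hU⟩
      exact ⟨a, b, V1, V3, hX, hU⟩

theorem ec_A22 (hη : IsBasisUnit S.η) : S.ec S.A22 =
    colBlock (projR (S.ec S.A1) : Tensor dJ dJ) (projR (S.ec S.Ahat4) : Tensor dJ dJ) := by
  rw [A22, ec, etaConj_rowBlock, etaConj_projL hη, etaConj_projL hη]

/-- `X` is parametrized both by its own equation and by the one for `G`. Matching them determines
`U1`, `U2` and leaves a condition on `V2`. -/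
theorem X33_merge (hN : 0 < N) (hη : IsBasisUnit S.η) {X U1 U2 : Tensor dJ dJ}
    {V2 : Tensor dP dP}
    (hX : X = S.A1† * S.E1 * S.ec S.A1† + projL S.A1 * U1 + U2 * projR (S.ec S.A1)) :
    (∃ a b : Tensor dJ dJ,
      X = S.Ahat4† * S.G * (S.ec S.Ahat4)†
        - S.Ahat4† * S.S1 * S.C6† * S.G * (S.ec S.M1)† * S.ec S.C6 * (S.ec S.Ahat4)†
        - S.Ahat4† * S.C6 * S.M1† * S.G * (S.ec S.Ahat4)†
        - S.Ahat4† * S.S1 * V2 * projR (S.ec S.M1) * S.ec S.C6 * (S.ec S.Ahat4)†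
        + projL S.Ahat4 * a + b * projR (S.ec S.Ahat4)) ↔
    projR S.A22 * (S.E22 - S.C22 * V2 * S.ec S.C22) * projL (S.ec S.A22) = 0 ∧
      ∃ (H12 : Tensor dJ (dJ + dJ)) (H11 : Tensor (dJ + dJ) dJ) (H13 : Tensor dJ (dJ + dJ)),
        U1 = selRow dJ dJ * (S.A22† * (S.E22 - S.C22 * V2 * S.ec S.C22)
          - S.A22† * H12 * S.ec S.A22 + projL S.A22 * H11) ∧
        U2 = (projR S.A22 * (S.E22 - S.C22 * V2 * S.ec S.C22) * S.ec S.A22†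
          + S.A22 * S.A22† * H12 + H13 * projR (S.ec S.A22)) * selCol dJ dJ := by
  rw [hX, exists_param_eq_iff, block_sylvester_iff' hN (A := S.A22) rfl (ec_A22 hη)]
  -- As `S1 = C6 L_{M1}`, the `V2` term of the second form is `C22 V2 C22^{η*}`.
  have hC : S.Ahat4† * S.G * (S.ec S.Ahat4)†
        - S.Ahat4† * S.S1 * S.C6† * S.G * (S.ec S.M1)† * S.ec S.C6 * (S.ec S.Ahat4)†
        - S.Ahat4† * S.C6 * S.M1† * S.G * (S.ec S.Ahat4)†
        - S.Ahat4† * S.S1 * V2 * projR (S.ec S.M1) * S.ec S.C6 * (S.ec S.Ahat4)†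
        - S.A1† * S.E1 * S.ec S.A1† = S.E22 - S.C22 * V2 * S.ec S.C22 := by
    rw [E22, C22, ec_mul hη, ec_mul hη, ec_projL hη, ec_mpInv hη, ec_mpInv hη, ec_mpInv hη]
    simp only [S1, Matrix.mul_assoc]
    abel
  rw [hC, ec_mpInv hη]

/-- Distributing the outer projections turns the condition into `A33 V2 A33^{η*} = E33`, an equation
of the form `A X B = C`. -/
theorem V2_iff (hη : IsBasisUnit S.η) {V2 : Tensor dP dP} :
    projR S.A22 * (S.E22 - S.C22 * V2 * S.ec S.C22) * projL (S.ec S.A22) = 0 ↔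
      projR S.A33 * S.E33 = 0 ∧ S.E33 * projL (S.ec S.A33) = 0 ∧
      ∃ a b : Tensor dP dP, V2 = S.A33† * S.E33 * S.ec S.A33† + projL S.A33 * a
        + b * projR (S.ec S.A33) := by
  have h : projR S.A22 * (S.E22 - S.C22 * V2 * S.ec S.C22) * projL (S.ec S.A22) = 0 ↔
      S.A33 * V2 * S.ec S.A33 = S.E33 := by
    rw [eq_comm (b := S.E33), ← sub_eq_zero (a := S.E33), E33, A33, ec_mul hη, ec_projR hη]
    simp only [Matrix.mul_sub, Matrix.sub_mul, Matrix.mul_assoc]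
  rw [h, mul_mul_eq_iff, ec_mpInv hη]

/-! ### Exchanging the two halves of the system -/

/-- The system in which the two halves are exchanged. -/
def swap (S : Coeffs dI dJ dQ dP dE dR) : Coeffs dI dQ dJ dP dR dE where
  η := S.η
  A1 := S.A2
  A2 := S.A1
  A3 := S.A3
  A6 := S.A8
  A8 := S.A6
  C3 := S.H3
  C4 := S.H4
  H3 := S.C3
  H4 := S.C4
  E1 := S.E2
  E2 := S.E1
  E3 := S.E3
  E9 := S.E10
  E10 := S.E9

theorem eq10_iff (hη : IsBasisUnit S.η) {Y11 : Tensor dR dI} {Y12 : Tensor dI dR}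
    {Y : Tensor dQ dQ} {W : Tensor dP dP} :
    S.A8 * Y11 + Y12 * S.ec S.A8 + S.H3 * Y * S.ec S.H3 + S.H4 * W * S.ec S.H4 = S.E10 ↔
      S.Ahat5 * Y * S.ec S.Ahat5 + S.Chat5 * W * S.ec S.Chat5 = S.Qhat ∧
      ∃ (T : Tensor dR dR) (T3 : Tensor dI dR) (T4 : Tensor dR dI),
        Y11 = S.A8† * S.Egrave2 Y W - T * S.ec S.A8 + projL S.A8 * T4 ∧
        Y12 = projR S.A8 * S.Egrave2 Y W * S.ec S.A8† + S.A8 * T + T3 * projR (S.ec S.A8) :=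
  eq9_iff (S := S.swap) hη

theorem eq_Qhat_iff (hη : IsBasisUnit S.η) {Y : Tensor dQ dQ} {U W : Tensor dP dP}
    (hW : W = S.A3† * S.E3 + projL S.A3 * S.ec S.E3 * S.ec S.A3†
        + projL S.A3 * U * projR (S.ec S.A3)) :
    S.Ahat5 * Y * S.ec S.Ahat5 + S.Chat5 * W * S.ec S.Chat5 = S.Qhat ↔
      S.Ahat5 * Y * S.ec S.Ahat5 + S.C7 * U * S.ec S.C7 = S.F :=
  eq_Phat_iff (S := S.swap) hη hW

theorem eq_F_iff (hη : IsBasisUnit S.η) {Y : Tensor dQ dQ} {U : Tensor dP dP} :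
    S.Ahat5 * Y * S.ec S.Ahat5 + S.C7 * U * S.ec S.C7 = S.F ↔
      (projR S.Ahat5 * S.F * projL (S.ec S.C7) = 0 ∧ projR S.C7 * S.F * projL (S.ec S.Ahat5) = 0 ∧
        projR S.M2 * projR S.Ahat5 * S.F = 0 ∧
        S.F * projL (S.ec S.Ahat5) * projL (S.ec S.M2) = 0) ∧
      ∃ T2 : Tensor dP dP,
        (∃ a b : Tensor dQ dQ,
          Y = S.Ahat5† * S.F * (S.ec S.Ahat5)†
            - S.Ahat5† * S.S2 * S.C7† * S.F * (S.ec S.M2)† * S.ec S.C7 * (S.ec S.Ahat5)†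
            - S.Ahat5† * S.C7 * S.M2† * S.F * (S.ec S.Ahat5)†
            - S.Ahat5† * S.S2 * T2 * projR (S.ec S.M2) * S.ec S.C7 * (S.ec S.Ahat5)†
            + projL S.Ahat5 * a + b * projR (S.ec S.Ahat5)) ∧
        ∃ T1 T3 : Tensor dP dP,
          U = S.M2† * S.F * (S.ec S.C7)† + S.S2† * S.S2 * S.C7† * S.F * (S.ec S.M2)†
            + projL S.M2 * projL S.S2 * T1 + projL S.M2 * T2 * projR (S.ec S.M2)
            + T3 * projR (S.ec S.C7) :=
  eq_G_iff (S := S.swap) hη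

theorem Y33_merge (hN : 0 < N) (hη : IsBasisUnit S.η) {Y U3 U4 : Tensor dQ dQ}
    {T2 : Tensor dP dP}
    (hY : Y = S.A2† * S.E2 * S.ec S.A2† + projL S.A2 * U3 + U4 * projR (S.ec S.A2)) :
    (∃ a b : Tensor dQ dQ,
      Y = S.Ahat5† * S.F * (S.ec S.Ahat5)†
        - S.Ahat5† * S.S2 * S.C7† * S.F * (S.ec S.M2)† * S.ec S.C7 * (S.ec S.Ahat5)†
        - S.Ahat5† * S.C7 * S.M2† * S.F * (S.ec S.Ahat5)†
        - S.Ahat5† * S.S2 * T2 * projR (S.ec S.M2) * S.ec S.C7 * (S.ec S.Ahat5)†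
        + projL S.Ahat5 * a + b * projR (S.ec S.Ahat5)) ↔
    projR S.A44 * (S.E44 - S.C44 * T2 * S.ec S.C44) * projL (S.ec S.A44) = 0 ∧
      ∃ (H22 : Tensor dQ (dQ + dQ)) (H21 : Tensor (dQ + dQ) dQ) (H23 : Tensor dQ (dQ + dQ)),
        U3 = selRow dQ dQ * (S.A44† * (S.E44 - S.C44 * T2 * S.ec S.C44)
          - S.A44† * H22 * S.ec S.A44 + projL S.A44 * H21) ∧
        U4 = (projR S.A44 * (S.E44 - S.C44 * T2 * S.ec S.C44) * S.ec S.A44†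
          + S.A44 * S.A44† * H22 + H23 * projR (S.ec S.A44)) * selCol dQ dQ :=
  X33_merge (S := S.swap) hN hη hY

theorem T2_iff (hη : IsBasisUnit S.η) {T2 : Tensor dP dP} :
    projR S.A44 * (S.E44 - S.C44 * T2 * S.ec S.C44) * projL (S.ec S.A44) = 0 ↔
      projR S.A55 * S.E55 = 0 ∧ S.E55 * projL (S.ec S.A55) = 0 ∧
      ∃ a b : Tensor dP dP, T2 = S.A55† * S.E55 * S.ec S.A55† + projL S.A55 * a
        + b * projR (S.ec S.A55) :=
  V2_iff (S := S.swap) hη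

/-! ### Coupling of the two halves -/

/-- Both halves of the system parametrize `U5`. The terms in `V2` and `T2` count as constants and
are collected in `V0`; `T1` and `T3` are discarded. -/
theorem U5_merge (hN : 0 < N) (hη : IsBasisUnit S.η) {U V1 V2 V3 T2 V0 : Tensor dP dP}
    (hU : U = S.M1† * S.G * S.ec S.C6† + S.S1† * S.S1 * S.C6† * S.G * S.ec S.M1†
      + projL S.M1 * projL S.S1 * V1 + projL S.M1 * V2 * projR (S.ec S.M1)
      + V3 * projR (S.ec S.C6))
    (hV0 : V0 = S.E11 - projL S.M1 * V2 * projR (S.ec S.M1)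
      + projL S.M2 * T2 * projR (S.ec S.M2)) :
    (∃ T1 T3 : Tensor dP dP,
      U = S.M2† * S.F * (S.ec S.C7)† + S.S2† * S.S2 * S.C7† * S.F * (S.ec S.M2)†
        + projL S.M2 * projL S.S2 * T1 + projL S.M2 * T2 * projR (S.ec S.M2)
        + T3 * projR (S.ec S.C7)) ↔
    projR S.A11 * V0 * projL S.B11 = 0 ∧
      ∃ (Z1 : Tensor (dP + dP) (dP + dP)) (Z2 : Tensor (dP + dP) dP) (Z3 : Tensor dP (dP + dP)),
        V1 = selRow dP dP * (S.A11† * V0 + Z1 * S.B11 + projL S.A11 * Z2) ∧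
        V3 = (projR S.A11 * V0 * S.B11† - S.A11 * Z1 - Z3 * projR S.B11) * selCol dP dP := by
  rw [hU, add_right_comm _ (projL S.M1 * projL S.S1 * V1)]
  simp only [add_right_comm _ (projL S.M2 * projL S.S2 * _)
    (projL S.M2 * T2 * projR (S.ec S.M2))]
  rw [exists_param_eq_iff, block_sylvester_iff hN (A := S.A11) (B := S.B11) rfl rfl]
  have hC : S.M2† * S.F * (S.ec S.C7)† + S.S2† * S.S2 * S.C7† * S.F * (S.ec S.M2)†
        + projL S.M2 * T2 * projR (S.ec S.M2)
        - (S.M1† * S.G * S.ec S.C6† + S.S1† * S.S1 * S.C6† * S.G * S.ec S.M1†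
          + projL S.M1 * V2 * projR (S.ec S.M1)) = V0 := by
    rw [hV0, E11, ec_mpInv hη, ec_mpInv hη, ec_mpInv hη, ec_mpInv hη]
    abel
  rw [hC]

/-- The solvability condition of the `U5` matching expands to `A V2 B - C T2 D = E`, which couples
the two halves. Its solution introduces `W4`, common to `V2` and `T2`. -/
theorem V0_iff {V2 T2 V0 : Tensor dP dP}
    (hV0 : V0 = S.E11 - projL S.M1 * V2 * projR (S.ec S.M1)
      + projL S.M2 * T2 * projR (S.ec S.M2)) :
    projR S.A11 * V0 * projL S.B11 = 0 ↔
      (projR S.M * projR S.A * S.E = 0 ∧ projR S.A * S.E * projL S.D = 0 ∧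
        S.E * projL S.B * projL S.N' = 0 ∧ projR S.C * S.E * projL S.B = 0) ∧
      ∃ W4 W5 W6 W7 W8 : Tensor dP dP,
        V2 = S.A† * S.E * S.B† - S.A† * S.S' * S.C† * S.E * S.N'† * S.D * S.B†
          - S.A† * S.C * S.M† * S.E * S.B† + S.A† * S.S' * W4 * projR S.N' * S.D * S.B†
          + projL S.A * W5 + W6 * projR S.B ∧
        T2 = -(S.M† * S.E * S.D†) - S.S'† * S.S' * S.C† * S.E * S.N'†
          + projL S.M * projL S.S' * W7 + projL S.M * W4 * projR S.N' + W8 * projR S.D := by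
  have h : projR S.A11 * V0 * projL S.B11 = 0 ↔ S.A * V2 * S.B - S.C * T2 * S.D = S.E := by
    rw [eq_comm (b := S.E), ← sub_eq_zero (a := S.E), hV0, E, A, B, C, D]
    refine Eq.congr ?_ rfl
    simp only [Matrix.mul_sub, Matrix.sub_mul, Matrix.mul_add, Matrix.add_mul, Matrix.mul_assoc]
    abel
  rw [h, two_term_sub_iff (M := S.M) (N := S.N') (S := S.S') rfl rfl rfl]

/-- The coupling equation and the equation for `E33` both parametrize `V2`. With `W4` held fixed,
matching them determines `W5` and `W6`. -/
theorem V2_merge (hN : 0 < N) {V2 W4 W5 W6 : Tensor dP dP}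
    (hV2 : V2 = S.A† * S.E * S.B† - S.A† * S.S' * S.C† * S.E * S.N'† * S.D * S.B†
      - S.A† * S.C * S.M† * S.E * S.B† + S.A† * S.S' * W4 * projR S.N' * S.D * S.B†
      + projL S.A * W5 + W6 * projR S.B) :
    (∃ a b : Tensor dP dP, V2 = S.A33† * S.E33 * S.ec S.A33† + projL S.A33 * a
      + b * projR (S.ec S.A33)) ↔
    projR S.A66 * (S.E66 - S.C66 * W4 * S.D66) * projL S.B66 = 0 ∧
      ∃ (H32 : Tensor dP (dP + dP)) (H31 : Tensor (dP + dP) dP) (H33 : Tensor dP (dP + dP)),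
        W5 = selRow dP dP * (S.A66† * (S.E66 - S.C66 * W4 * S.D66) - S.A66† * H32 * S.B66
          + projL S.A66 * H31) ∧
        W6 = (projR S.A66 * (S.E66 - S.C66 * W4 * S.D66) * S.B66† + S.A66 * S.A66† * H32
          + H33 * projR S.B66) * selCol dP dP := by
  rw [hV2, exists_param_eq_iff, block_sylvester_iff' hN (A := S.A66) (B := S.B66) rfl rfl]
  have hC : S.A33† * S.E33 * S.ec S.A33† -
      (S.A† * S.E * S.B† - S.A† * S.S' * S.C† * S.E * S.N'† * S.D * S.B†
      - S.A† * S.C * S.M† * S.E * S.B† + S.A† * S.S' * W4 * projR S.N' * S.D * S.B†)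
      = S.E66 - S.C66 * W4 * S.D66 := by
    rw [E66, C66, D66]
    simp only [Matrix.mul_assoc]
    abel
  rw [hC]

theorem T2_merge (hN : 0 < N) {T2 W4 W7 W8 : Tensor dP dP}
    (hT2 : T2 = -(S.M† * S.E * S.D†) - S.S'† * S.S' * S.C† * S.E * S.N'†
      + projL S.M * projL S.S' * W7 + projL S.M * W4 * projR S.N' + W8 * projR S.D) :
    (∃ a b : Tensor dP dP, T2 = S.A55† * S.E55 * S.ec S.A55† + projL S.A55 * a
      + b * projR (S.ec S.A55)) ↔
    projR S.A88 * (S.E88 - S.C88 * W4 * S.D88) * projL S.B88 = 0 ∧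
      ∃ (H42 : Tensor dP (dP + dP)) (H41 : Tensor (dP + dP) dP) (H43 : Tensor dP (dP + dP)),
        W7 = selRow dP dP * (S.A88† * (S.E88 - S.C88 * W4 * S.D88) - S.A88† * H42 * S.B88
          + projL S.A88 * H41) ∧
        W8 = (projR S.A88 * (S.E88 - S.C88 * W4 * S.D88) * S.B88† + S.A88 * S.A88† * H42
          + H43 * projR S.B88) * selCol dP dP := by
  rw [hT2, add_right_comm _ (projL S.M * projL S.S' * W7), exists_param_eq_iff,
    block_sylvester_iff' hN (A := S.A88) (B := S.B88) rfl rfl]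
  have hC : S.A55† * S.E55 * S.ec S.A55† -
      (-(S.M† * S.E * S.D†) - S.S'† * S.S' * S.C† * S.E * S.N'† + projL S.M * W4 * projR S.N')
      = S.E88 - S.C88 * W4 * S.D88 := by
    rw [E88, C88, D88]
    abel
  rw [hC]

theorem W4_iff_of_V2 {W4 : Tensor dP dP} :
    projR S.A66 * (S.E66 - S.C66 * W4 * S.D66) * projL S.B66 = 0 ↔
      projR S.A77 * S.E77 = 0 ∧ S.E77 * projL S.B77 = 0 ∧
      ∃ a b : Tensor dP dP, W4 = S.A77† * S.E77 * S.B77† - projL S.A77 * a - b * projR S.B77 := by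
  have h : projR S.A66 * (S.E66 - S.C66 * W4 * S.D66) * projL S.B66 = 0 ↔
      S.A77 * W4 * S.B77 = S.E77 := by
    rw [eq_comm (b := S.E77), ← sub_eq_zero (a := S.E77), E77, A77, B77]
    simp only [Matrix.mul_sub, Matrix.sub_mul, Matrix.mul_assoc]
  rw [h, mul_mul_eq_iff']

theorem W4_iff_of_T2 {W4 : Tensor dP dP} :
    projR S.A88 * (S.E88 - S.C88 * W4 * S.D88) * projL S.B88 = 0 ↔
      projR S.A99 * S.E99 = 0 ∧ S.E99 * projL S.B99 = 0 ∧
      ∃ a b : Tensor dP dP, W4 = S.A99† * S.E99 * S.B99† - projL S.A99 * a - b * projR S.B99 := by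
  have h : projR S.A88 * (S.E88 - S.C88 * W4 * S.D88) * projL S.B88 = 0 ↔
      S.A99 * W4 * S.B99 = S.E99 := by
    rw [eq_comm (b := S.E99), ← sub_eq_zero (a := S.E99), E99, A99, B99]
    simp only [Matrix.mul_sub, Matrix.sub_mul, Matrix.mul_assoc]
  rw [h, mul_mul_eq_iff']

/-- The elimination ends here: the remaining solvability condition contains no unknown. -/
theorem W4_merge (hN : 0 < N) {W4 Q1 Q2 : Tensor dP dP}
    (hW4 : W4 = S.A77† * S.E77 * S.B77† - projL S.A77 * Q1 - Q2 * projR S.B77) :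
    (∃ a b : Tensor dP dP, W4 = S.A99† * S.E99 * S.B99† - projL S.A99 * a - b * projR S.B99) ↔
    projR S.Atilde * S.Etilde * projL S.Btilde = 0 ∧
      ∃ (K2 : Tensor dP (dP + dP)) (K1 : Tensor (dP + dP) dP) (K3 : Tensor dP (dP + dP)),
        Q1 = selRow dP dP * (S.Atilde† * S.Etilde - S.Atilde† * K2 * S.Btilde
          + projL S.Atilde * K1) ∧
        Q2 = (projR S.Atilde * S.Etilde * S.Btilde† + S.Atilde * S.Atilde† * K2
          + K3 * projR S.Btilde) * selCol dP dP := by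
  rw [hW4, exists_param_eq_iff',
    block_sylvester_iff' hN (A := S.Atilde) (B := S.Btilde) rfl rfl, ← Etilde]

end Coeffs

/-! ### Assembly of the general solution, and symmetrization -/

namespace Coeffs

variable {N : ℕ} {dI dJ dQ dP dE dR : Fin N → ℕ} {S : Coeffs dI dJ dQ dP dE dR}

/-- Since `E1` is `η`-Hermitian, the second condition of `mul_mul_eq_iff` is the conjugate of the
first. -/
theorem eq1_iff (hη : IsBasisUnit S.η) (hE1 : IsEtaHermitian S.η S.E1) {X : Tensor dJ dJ} :
    S.A1 * X * S.ec S.A1 = S.E1 ↔ projR S.A1 * S.E1 = 0 ∧ ∃ U V : Tensor dJ dJ,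
      X = S.A1† * S.E1 * S.ec S.A1† + projL S.A1 * U + V * projR (S.ec S.A1) := by
  rw [mul_mul_eq_iff, ec_mpInv hη]
  refine and_congr_right fun h => and_iff_right ?_
  have h' := congrArg S.ec h
  rw [ec_mul hη, ec_projR hη, ec, ← hE1] at h'
  rw [h']
  exact etaConj_zero

theorem eq2_iff (hη : IsBasisUnit S.η) (hE2 : IsEtaHermitian S.η S.E2) {Y : Tensor dQ dQ} :
    S.A2 * Y * S.ec S.A2 = S.E2 ↔ projR S.A2 * S.E2 = 0 ∧ ∃ U V : Tensor dQ dQ,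
      Y = S.A2† * S.E2 * S.ec S.A2† + projL S.A2 * U + V * projR (S.ec S.A2) :=
  eq1_iff (S := S.swap) hη hE2

/-- The general solution of the associated system. -/
theorem isAuxSolution_iff (hN : 0 < N) (hη : IsBasisUnit S.η) (hE1 : IsEtaHermitian S.η S.E1)
    (hE2 : IsEtaHermitian S.η S.E2) {X11 : Tensor dE dI} {X12 : Tensor dI dE}
    {Y11 : Tensor dR dI} {Y12 : Tensor dI dR} {X33 : Tensor dJ dJ} {Y33 : Tensor dQ dQ}
    {W1 : Tensor dP dP} :
    S.IsAuxSolution X11 X12 Y11 Y12 X33 Y33 W1 ↔ S.Conditions ∧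
      ∃ p : Params dI dJ dQ dP dE dR,
        X33 = S.X33 p ∧ Y33 = S.Y33 p ∧ W1 = S.W1 p ∧
        X11 = S.X11 p (S.Egrave1 X33 W1) ∧ X12 = S.X12 p (S.Egrave1 X33 W1) ∧
        Y11 = S.Y11 p (S.Egrave2 Y33 W1) ∧ Y12 = S.Y12 p (S.Egrave2 Y33 W1) := by
  constructor
  · rintro ⟨e1, e2, e3, e4, e9, e10⟩
    obtain ⟨c3, U1, U2, hX⟩ := (eq1_iff hη hE1).1 e1
    obtain ⟨c4, U3, U4, hY⟩ := (eq2_iff hη hE2).1 e2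
    obtain ⟨c1, c2, U5, hW⟩ := (eq3_iff hη).1 ⟨e3, e4⟩
    obtain ⟨hP, That21, T31, T41, hX11, hX12⟩ := (eq9_iff hη).1 e9
    obtain ⟨hQ, Jhat21, J31, J41, hY11, hY12⟩ := (eq10_iff hη).1 e10
    obtain ⟨⟨c5, c6, c7, c8⟩, V2, hXV, V1, V3, hU⟩ := (eq_G_iff hη).1 ((eq_Phat_iff hη hW).1 hP)
    obtain ⟨⟨c9, c10, c11, c12⟩, T2, hYT, hUT⟩ := (eq_F_iff hη).1 ((eq_Qhat_iff hη hW).1 hQ)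
    obtain ⟨hV, H12, H11, H13, hU1, hU2⟩ := (X33_merge hN hη hX).1 hXV
    obtain ⟨hT, H22, H21, H23, hU3, hU4⟩ := (Y33_merge hN hη hY).1 hYT
    obtain ⟨c17, c18, hV33⟩ := (V2_iff hη).1 hV
    obtain ⟨c19, c20, hT55⟩ := (T2_iff hη).1 hT
    rw [← ec_mpInv hη, ← ec_mpInv hη] at hU
    obtain ⟨h0, Z1, Z2, Z3, hV1, hV3⟩ := (U5_merge hN hη hU rfl).1 hUT
    obtain ⟨⟨c13, c14, c15, c16⟩, W4, W5, W6, W7, W8, hV2, hT2⟩ := (V0_iff rfl).1 h0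
    obtain ⟨h66, H32, H31, H33, hW5, hW6⟩ := (V2_merge hN hV2).1 hV33
    obtain ⟨h88, H42, H41, H43, hW7, hW8⟩ := (T2_merge hN hT2).1 hT55
    obtain ⟨c21, c22, Q1, Q2, hW4⟩ := W4_iff_of_V2.1 h66
    obtain ⟨c23, c24, h99⟩ := W4_iff_of_T2.1 h88
    obtain ⟨c25, K2, K1, K3, hQ1, hQ2⟩ := (W4_merge hN hW4).1 h99
    refine ⟨⟨c1, c2, c3, c4, c5, c6, c7, c8, c9, c10, c11, c12, c13, c14, c15, c16, c17, c18,
      c19, c20, c21, c22, c23, c24, c25⟩, ⟨Z1, Z2, Z3, K1, K2, K3, H11, H12, H13, H21, H22, H23,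
      H31, H32, H33, H41, H42, H43, That21, T31, T41, Jhat21, J31, J41⟩, ?_⟩
    -- With the parameter tuple made opaque, the tensors are identified from the innermost (`Q1`,
    -- `Q2`, `W4`) outward, since each formula contains the earlier ones.
    generalize hp : (⟨Z1, Z2, Z3, K1, K2, K3, H11, H12, H13, H21, H22, H23,
      H31, H32, H33, H41, H42, H43, That21, T31, T41, Jhat21, J31, J41⟩ :
      Params dI dJ dQ dP dE dR) = p
    have q1 : Q1 = S.Q1 p := by subst hp; exact hQ1
    have q2 : Q2 = S.Q2 p := by subst hp; exact hQ2
    have w4 : W4 = S.W4 p := by rw [hW4, q1, q2]; rfl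
    have w5 : W5 = S.W5 p := by rw [hW5, w4]; subst hp; rfl
    have w6 : W6 = S.W6 p := by rw [hW6, w4]; subst hp; rfl
    have w7 : W7 = S.W7 p := by rw [hW7, w4]; subst hp; rfl
    have w8 : W8 = S.W8 p := by rw [hW8, w4]; subst hp; rfl
    have v2 : V2 = S.V2 p := by rw [hV2, w4, w5, w6]; rfl
    have t2 : T2 = S.T2 p := by rw [hT2, w4, w7, w8]; rfl
    have v1 : V1 = S.V1 p := by rw [hV1, v2, t2]; subst hp; rfl
    have v3 : V3 = S.V3 p := by rw [hV3, v2, t2]; subst hp; rfl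
    have u1 : U1 = S.U1 p := by rw [hU1, v2]; subst hp; rfl
    have u2 : U2 = S.U2 p := by rw [hU2, v2]; subst hp; rfl
    have u3 : U3 = S.U3 p := by rw [hU3, t2]; subst hp; rfl
    have u4 : U4 = S.U4 p := by rw [hU4, t2]; subst hp; rfl
    have u5 : U5 = S.U5 p := by rw [hU, v1, v2, v3]; rfl
    have x33 : X33 = S.X33 p := by rw [hX, u1, u2]; rfl
    have y33 : Y33 = S.Y33 p := by rw [hY, u3, u4]; rfl
    have w1 : W1 = S.W1 p := by rw [hW, u5]; rfl
    refine ⟨x33, y33, w1, ?_, ?_, ?_, ?_⟩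
    · rw [hX11]; subst hp; rfl
    · rw [hX12]; subst hp; rfl
    · rw [hY11]; subst hp; rfl
    · rw [hY12]; subst hp; rfl
  · rintro ⟨c, p, hX, hY, hW, hX11, hX12, hY11, hY12⟩
    -- The same equivalences are read backwards, starting from the innermost parameter.
    have h99 := (W4_merge hN (S := S) (W4 := S.W4 p) rfl).2 ⟨c.c25, p.K2, p.K1, p.K3, rfl, rfl⟩
    have h66 := (W4_iff_of_V2 (S := S) (W4 := S.W4 p)).2 ⟨c.c21, c.c22, S.Q1 p, S.Q2 p, rfl⟩
    have h88 := W4_iff_of_T2.2 ⟨c.c23, c.c24, h99⟩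
    have hV33 := (V2_merge hN (S := S) (V2 := S.V2 p) rfl).2
      ⟨h66, p.H32, p.H31, p.H33, rfl, rfl⟩
    have hT55 := (T2_merge hN (S := S) (T2 := S.T2 p) rfl).2
      ⟨h88, p.H42, p.H41, p.H43, rfl, rfl⟩
    have h0 := (V0_iff (S := S) (V0 := S.V0 p) rfl).2 ⟨⟨c.c13, c.c14, c.c15, c.c16⟩,
      S.W4 p, S.W5 p, S.W6 p, S.W7 p, S.W8 p, rfl, rfl⟩
    have hUT := (U5_merge hN hη (S := S) (U := S.U5 p) (V0 := S.V0 p) rfl rfl).2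
      ⟨h0, p.Z1, p.Z2, p.Z3, rfl, rfl⟩
    have hV := (V2_iff hη).2 ⟨c.c17, c.c18, hV33⟩
    have hT := (T2_iff hη).2 ⟨c.c19, c.c20, hT55⟩
    have hXV := (X33_merge hN hη hX).2 ⟨hV, p.H12, p.H11, p.H13, rfl, rfl⟩
    have hYT := (Y33_merge hN hη hY).2 ⟨hT, p.H22, p.H21, p.H23, rfl, rfl⟩
    have hU : S.U5 p = S.M1† * S.G * (S.ec S.C6)†
        + S.S1† * S.S1 * S.C6† * S.G * (S.ec S.M1)† + projL S.M1 * projL S.S1 * S.V1 p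
        + projL S.M1 * S.V2 p * projR (S.ec S.M1) + S.V3 p * projR (S.ec S.C6) := by
      rw [U5, ec_mpInv hη, ec_mpInv hη]
    have hG := (eq_G_iff hη).2 ⟨⟨c.c5, c.c6, c.c7, c.c8⟩, S.V2 p, hXV, S.V1 p, S.V3 p, hU⟩
    have hF := (eq_F_iff hη).2 ⟨⟨c.c9, c.c10, c.c11, c.c12⟩, S.T2 p, hYT, hUT⟩
    have e34 := (eq3_iff hη).2 ⟨c.c1, c.c2, S.U5 p, hW⟩
    exact ⟨(eq1_iff hη hE1).2 ⟨c.c3, S.U1 p, S.U2 p, hX⟩,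
      (eq2_iff hη hE2).2 ⟨c.c4, S.U3 p, S.U4 p, hY⟩, e34.1, e34.2,
      (eq9_iff hη).2 ⟨(eq_Phat_iff hη hW).2 hG, p.That21, p.T31, p.T41, hX11, hX12⟩,
      (eq10_iff hη).2 ⟨(eq_Qhat_iff hη hW).2 hF, p.Jhat21, p.J31, p.J41, hY11, hY12⟩⟩

/-! ### Symmetrization -/

section Symm

variable {m n : Type}

theorem ec_symm (hη : IsBasisUnit S.η) (X : Matrix m n ℍ[ℝ]) (Y : Matrix n m ℍ[ℝ]) :
    S.ec (S.symm X Y) = S.symm Y X := by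
  rw [symm, symm, ec, etaConj_smul]
  refine congrArg _ ?_
  rw [← ec, ec_add, ec_ec hη, add_comm]

theorem symm_of_eq (hη : IsBasisUnit S.η) {X : Matrix m n ℍ[ℝ]} {Y : Matrix n m ℍ[ℝ]}
    (h : Y = S.ec X) : S.symm X Y = X := by
  rw [symm, h, ec_ec hη, ← two_smul ℝ X, smul_smul, inv_mul_cancel₀ two_ne_zero, one_smul]

theorem mul_symm_mul [Fintype m] (hη : IsBasisUnit S.η) {k : Type} (A : Matrix k m ℍ[ℝ])
    (X : Matrix m m ℍ[ℝ]) : A * S.symm X X * S.ec A = S.symm (A * X * S.ec A) (A * X * S.ec A) := by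
  rw [symm, symm, Matrix.mul_smul, Matrix.smul_mul, ec_mul hη, ec_mul hη, ec_ec hη,
    Matrix.mul_add, Matrix.add_mul, Matrix.mul_assoc A (S.ec X)]

theorem symm_add (X X' : Matrix m n ℍ[ℝ]) (Y Y' : Matrix n m ℍ[ℝ]) :
    S.symm (X + X') (Y + Y') = S.symm X Y + S.symm X' Y' := by
  rw [symm, symm, symm, ← smul_add, ec_add]
  congr 1
  abel

theorem mul_symm [Fintype m] (hη : IsBasisUnit S.η) {k : Type} (A : Matrix k m ℍ[ℝ])
    (X : Matrix m n ℍ[ℝ]) (Y : Matrix n m ℍ[ℝ]) :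
    A * S.symm X Y = S.symm (A * X) (Y * S.ec A) := by
  rw [symm, symm, Matrix.mul_smul, Matrix.mul_add, ec_mul hη, ec_ec hη]

/-- The two symmetrized products are conjugate to each other, so the left side built from `S.symm X
Y` is the symmetrization of the unsymmetric expression `A X + Y A^{η*}`. -/
theorem mul_symm_add_ec [Fintype m] (hη : IsBasisUnit S.η) (A : Matrix n m ℍ[ℝ])
    (X : Matrix m n ℍ[ℝ]) (Y : Matrix n m ℍ[ℝ]) :
    A * S.symm X Y + S.ec (A * S.symm X Y)
      = S.symm (A * X + Y * S.ec A) (A * X + Y * S.ec A) := by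
  rw [mul_symm hη, ec_symm hη, ← symm_add, symm, symm, ec_add, ec_add, add_comm (S.ec (Y * _))]

end Symm

theorem IsSolution.isAuxSolution (hη : IsBasisUnit S.η) {X1 : Tensor dE dI} {Y1 : Tensor dR dI}
    {X3 : Tensor dJ dJ} {Y3 : Tensor dQ dQ} {W : Tensor dP dP}
    (h : S.IsSolution X1 Y1 X3 Y3 W) :
    S.IsAuxSolution X1 (S.ec X1) Y1 (S.ec Y1) X3 Y3 W where
  eq1 := h.eq1
  eq2 := h.eq2
  eq3 := h.eq3
  eq4 := by
    rw [← h.eq3, ec_mul hη]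
    exact congrArg (· * S.ec S.A3) h.hermW
  eq9 := by rw [← ec_mul hη]; exact h.eq9
  eq10 := by rw [← ec_mul hη]; exact h.eq10

/-- Symmetrization is additive and compatible with the products in each equation, and it fixes
`η`-Hermitian right-hand sides. For `E3` the two one-sided equations for `W1` are averaged. -/
theorem IsAuxSolution.isSolution (hη : IsBasisUnit S.η) (hE1 : IsEtaHermitian S.η S.E1)
    (hE2 : IsEtaHermitian S.η S.E2) (hE9 : IsEtaHermitian S.η S.E9)
    (hE10 : IsEtaHermitian S.η S.E10) {X11 : Tensor dE dI} {X12 : Tensor dI dE}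
    {Y11 : Tensor dR dI} {Y12 : Tensor dI dR} {X33 : Tensor dJ dJ} {Y33 : Tensor dQ dQ}
    {W1 : Tensor dP dP} (h : S.IsAuxSolution X11 X12 Y11 Y12 X33 Y33 W1) :
    S.IsSolution (S.symm X11 X12) (S.symm Y11 Y12) (S.symm X33 X33) (S.symm Y33 Y33)
      (S.symm W1 W1) where
  eq1 := by rw [mul_symm_mul hη, h.eq1, symm_of_eq hη hE1]
  eq2 := by rw [mul_symm_mul hη, h.eq2, symm_of_eq hη hE2]
  eq3 := by rw [mul_symm hη, h.eq3, h.eq4, symm_of_eq hη rfl]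
  eq9 := by
    rw [mul_symm_add_ec hη, mul_symm_mul hη, mul_symm_mul hη, ← symm_add, ← symm_add, h.eq9,
      symm_of_eq hη hE9]
  eq10 := by
    rw [mul_symm_add_ec hη, mul_symm_mul hη, mul_symm_mul hη, ← symm_add, ← symm_add, h.eq10,
      symm_of_eq hη hE10]
  hermX3 := (ec_symm hη X33 X33).symm
  hermY3 := (ec_symm hη Y33 Y33).symm
  hermW := (ec_symm hη W1 W1).symm

/-- The solution of the associated system with given parameters. -/
theorem Conditions.isAuxSolution (hN : 0 < N) (hη : IsBasisUnit S.η)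
    (hE1 : IsEtaHermitian S.η S.E1) (hE2 : IsEtaHermitian S.η S.E2) (h : S.Conditions)
    (p : Params dI dJ dQ dP dE dR) :
    S.IsAuxSolution (S.X11 p (S.Egrave1 (S.X33 p) (S.W1 p)))
      (S.X12 p (S.Egrave1 (S.X33 p) (S.W1 p))) (S.Y11 p (S.Egrave2 (S.Y33 p) (S.W1 p)))
      (S.Y12 p (S.Egrave2 (S.Y33 p) (S.W1 p))) (S.X33 p) (S.Y33 p) (S.W1 p) :=
  (isAuxSolution_iff hN hη hE1 hE2).2 ⟨h, p, rfl, rfl, rfl, rfl, rfl, rfl, rfl⟩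

end Coeffs

end EtaSylvester

/-! ### The theorem -/

theorem theorem4p2 {N : ℕ} (hN : 0 < N) (dI dJ dQ dP dE dR : Fin N → ℕ)
    (S : EtaSylvester.Coeffs dI dJ dQ dP dE dR) (hη : EtaSylvester.IsBasisUnit S.η)
    (hE1 : EtaSylvester.IsEtaHermitian S.η S.E1) (hE2 : EtaSylvester.IsEtaHermitian S.η S.E2)
    (hE9 : EtaSylvester.IsEtaHermitian S.η S.E9)
    (hE10 : EtaSylvester.IsEtaHermitian S.η S.E10) :
    -- the solvability criterion
    (S.Solvable ↔ S.Conditions) ∧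
    -- the general solution
    (S.Conditions →
      ∀ (X1 : EtaSylvester.Tensor dE dI) (Y1 : EtaSylvester.Tensor dR dI)
        (X3 : EtaSylvester.Tensor dJ dJ) (Y3 : EtaSylvester.Tensor dQ dQ)
        (W : EtaSylvester.Tensor dP dP),
        S.IsSolution X1 Y1 X3 Y3 W ↔
          ∃ p : EtaSylvester.Params dI dJ dQ dP dE dR,
            X3 = S.symm (S.X33 p) (S.X33 p) ∧
            Y3 = S.symm (S.Y33 p) (S.Y33 p) ∧
            W = S.symm (S.W1 p) (S.W1 p) ∧
            X1 = S.symm (S.X11 p (S.Egrave1 X3 W)) (S.X12 p (S.Egrave1 X3 W)) ∧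
            Y1 = S.symm (S.Y11 p (S.Egrave2 Y3 W)) (S.Y12 p (S.Egrave2 Y3 W))) ∧
    -- the solutions are the symmetrizations of the solutions of the associated system
    (∀ (X1 : EtaSylvester.Tensor dE dI) (Y1 : EtaSylvester.Tensor dR dI)
        (X3 : EtaSylvester.Tensor dJ dJ) (Y3 : EtaSylvester.Tensor dQ dQ)
        (W : EtaSylvester.Tensor dP dP),
        S.IsSolution X1 Y1 X3 Y3 W ↔
          ∃ X11 X12 Y11 Y12 X33 Y33 W1, S.IsAuxSolution X11 X12 Y11 Y12 X33 Y33 W1 ∧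
            X1 = S.symm X11 X12 ∧ Y1 = S.symm Y11 Y12 ∧ X3 = S.symm X33 X33 ∧
            Y3 = S.symm Y33 Y33 ∧ W = S.symm W1 W1) ∧
    -- the general solution of the associated system, under the same conditions
    (S.Conditions →
      ∀ (X11 : EtaSylvester.Tensor dE dI) (X12 : EtaSylvester.Tensor dI dE)
        (Y11 : EtaSylvester.Tensor dR dI) (Y12 : EtaSylvester.Tensor dI dR)
        (X33 : EtaSylvester.Tensor dJ dJ) (Y33 : EtaSylvester.Tensor dQ dQ)
        (W1 : EtaSylvester.Tensor dP dP),
        S.IsAuxSolution X11 X12 Y11 Y12 X33 Y33 W1 ↔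
          ∃ p : EtaSylvester.Params dI dJ dQ dP dE dR,
            X33 = S.X33 p ∧ Y33 = S.Y33 p ∧ W1 = S.W1 p ∧
            X11 = S.X11 p (S.Egrave1 X33 W1) ∧ X12 = S.X12 p (S.Egrave1 X33 W1) ∧
            Y11 = S.Y11 p (S.Egrave2 Y33 W1) ∧ Y12 = S.Y12 p (S.Egrave2 Y33 W1)) := by
  open EtaSylvester EtaSylvester.Coeffs in
  refine ⟨⟨?_, ?_⟩, ?_, ?_, ?_⟩
  · rintro ⟨X1, Y1, X3, Y3, W, h⟩
    exact ((isAuxSolution_iff hN hη hE1 hE2).1 (h.isAuxSolution hη)).1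
  · intro hc
    -- Any parameter values give a solution; zero is the simplest choice.
    have p : Params dI dJ dQ dP dE dR := by constructor <;> exact 0
    exact ⟨_, _, _, _, _, (hc.isAuxSolution hN hη hE1 hE2 p).isSolution hη hE1 hE2 hE9 hE10⟩
  · intro hc X1 Y1 X3 Y3 W
    constructor
    · intro h
      obtain ⟨-, p, hX3, hY3, hW, hX11, hX12, hY11, hY12⟩ :=
        (isAuxSolution_iff hN hη hE1 hE2).1 (h.isAuxSolution hη)
      refine ⟨p, ?_, ?_, ?_, ?_, ?_⟩
      · rw [← hX3, symm_of_eq hη h.hermX3]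
      · rw [← hY3, symm_of_eq hη h.hermY3]
      · rw [← hW, symm_of_eq hη h.hermW]
      · rw [← hX11, ← hX12, symm_of_eq hη rfl]
      · rw [← hY11, ← hY12, symm_of_eq hη rfl]
    · rintro ⟨p, hX3, hY3, hW, hX1, hY1⟩
      -- The formulas for `X1`, `Y1` use the symmetrized `X3`, `Y3`, `W`, whereas the associated
      -- solution for `p` uses `X33`, `Y33`, `W1`. So that solution is symmetrized and regarded
      -- again as an associated one, now with components `X3`, `Y3`, `W`; its first four components
      -- are then replaced, which `eq9_iff` and `eq10_iff` permit. A second symmetrization leaves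
      -- `X3`, `Y3`, `W` unchanged.
      have h := ((hc.isAuxSolution hN hη hE1 hE2 p).isSolution hη hE1 hE2 hE9
        hE10).isAuxSolution hη
      rw [← hX3, ← hY3, ← hW] at h
      have h9 := ((eq9_iff hη).1 h.eq9).1
      have h10 := ((eq10_iff hη).1 h.eq10).1
      have h' : S.IsAuxSolution (S.X11 p (S.Egrave1 X3 W)) (S.X12 p (S.Egrave1 X3 W))
          (S.Y11 p (S.Egrave2 Y3 W)) (S.Y12 p (S.Egrave2 Y3 W)) X3 Y3 W :=
        ⟨h.eq1, h.eq2, h.eq3, h.eq4, (eq9_iff hη).2 ⟨h9, p.That21, p.T31, p.T41, rfl, rfl⟩,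
          (eq10_iff hη).2 ⟨h10, p.Jhat21, p.J31, p.J41, rfl, rfl⟩⟩
      have h'' := h'.isSolution hη hE1 hE2 hE9 hE10
      have symm_eq : ∀ {m : Type} (X : Matrix m m ℍ[ℝ]), S.symm (S.symm X X) (S.symm X X)
          = S.symm X X := fun X => symm_of_eq hη (ec_symm hη X X).symm
      rw [← hX1, ← hY1, hX3, hY3, hW, symm_eq, symm_eq, symm_eq] at h''
      rw [hX3, hY3, hW]
      exact h''
  · intro X1 Y1 X3 Y3 W
    constructor
    · intro h
      exact ⟨_, _, _, _, _, _, _, h.isAuxSolution hη, (symm_of_eq hη rfl).symm,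
        (symm_of_eq hη rfl).symm, (symm_of_eq hη h.hermX3).symm,
        (symm_of_eq hη h.hermY3).symm, (symm_of_eq hη h.hermW).symm⟩
    · rintro ⟨X11, X12, Y11, Y12, X33, Y33, W1, h, rfl, rfl, rfl, rfl, rfl⟩
      exact h.isSolution hη hE1 hE2 hE9 hE10
  · intro hc X11 X12 Y11 Y12 X33 Y33 W1
    rw [isAuxSolution_iff hN hη hE1 hE2, and_iff_right hc]
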